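/- There is a constant $C>0$ such that for every $\varepsilon\in(0,1/8)$ there is a polynomial-time randomized algorithm $\mathcal A$ which, given a finite loopless graph $G=(V,E)$ and a weight vector $w\in\mathbb R_{\ge 0}^E$, always outputs a matching $\mathcal A(G,w)\subseteq E$ of $G$, with the following two properties. (1) (Approximation) For all $G$ and $w$, $$\mathbb E\Big[\sum_{e\in\mathcal A(G,w)}w(e)\Big]\ \ge\ \Big(\frac18-\varepsilon\Big)\cdot\max\Big\{\sum_{e\in N}w(e)\ :\ N\subseteq E \text{ a matching of } G\Big\}.$$ (2) (Lipschitz continuity) For every $G$, the Lipschitz constant of $\mathcal A$ on $G$ is at most $C/\varepsilon$: $$\sup_{w\ne w'}\ \frac{\mathrm{EM}_{\mathrm w}\big((\mathcal A(G,w),w),(\mathcal A(G,w'),w')\big)}{\|w-w'\|_1}\ \le\ \frac{C}{\varepsilon},$$ where the supremum is over all pairs of distinct weight vectors $w,w'\in\mathbb R_{\ge0}^E$. Here, for distributions $\mathcal F,\mathcal F'$ over subsets of $E$, $$\mathrm{EM}_{\mathrm w}\big((\mathcal F,w),(\mathcal F',w')\big)=\min_{\mathcal D}\ \mathbb E_{(F,F')\sim\mathcal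 D}\Big\|\sum_{e\in F}w(e)\mathbf 1_e-\sum_{e\in F'}w'(e)\mathbf 1_e\Big\|_1,$$ the minimum being over all couplings $\mathcal D$ of $\mathcal F$ and $\mathcal F'$. Graphs may have parallel edges. "Polynomial-time" means: $\mathcal A$ is a program of a randomized real RAM (integer and real memory cells; addition, subtraction, comparison, multiplication of reals by rational constants of the program, and sampling of independent uniform reals from $[0,1]$, each at unit cost) that halts on every input, for every outcome of the samples, after a number of steps that is polynomial in the input size $|V|+|E|+\sum_{e:\,w(e)>0}\lceil|\log_2 w(e)|\rceil$. The program and the polynomial may depend on $\varepsilon$. -/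

import Mathlib

open MeasureTheory
open scoped NNReal ENNReal unitInterval

noncomputable section

namespace LipMatching

/-! ### Graphs, weights and matchings -/

/-- A finite loopless graph, given by its list of edges: the vertices are `0, …, n - 1`, and edge
`e` joins `src e` to `tgt e`.  Parallel edges are allowed, so every finite simple graph (after
numbering its vertices and edges) and every finite loopless multigraph is covered. -/
structure EdgeList where
  /-- number of vertices -/
  n : ℕ
  /-- number of edges -/
  m : ℕ
  src : Fin m → Fin n
  tgt : Fin m → Fin n
  loopless : ∀ e, src e ≠ tgt e

namespace EdgeList

/-- A weight vector in `ℝ≥0 ^ E`. -/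
abbrev Weights (G : EdgeList) : Type := Fin G.m → ℝ≥0

/-- The set of the two endpoints of an edge. -/
def ends (G : EdgeList) (e : Fin G.m) : Finset (Fin G.n) := {G.src e, G.tgt e}

/-- A matching: distinct edges of the set have no endpoint in common. -/
def IsMatching (G : EdgeList) (M : Finset (Fin G.m)) : Prop :=
  ∀ e ∈ M, ∀ f ∈ M, e ≠ f → Disjoint (G.ends e) (G.ends f)

/-- The total weight of an edge set. -/
def weight (G : EdgeList) (w : G.Weights) (F : Finset (Fin G.m)) : ℝ≥0 := ∑ e ∈ F, w e

open Classical in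
/-- The maximum weight of a matching (the empty set is a matching, of weight `0`). -/
def opt (G : EdgeList) (w : G.Weights) : ℝ≥0 :=
  (Finset.univ.filter fun M : Finset (Fin G.m) => G.IsMatching M).sup (G.weight w)

/-- The `ℓ₁` distance of two weight vectors. -/
def l1Dist (G : EdgeList) (w w' : G.Weights) : ℝ := ∑ e, |(w e : ℝ) - (w' e : ℝ)|

/-- The image of an edge set under the weighted mapping: the vector `∑_{e ∈ F} w(e) 1_e`. -/
def weightedVec (G : EdgeList) (F : Finset (Fin G.m)) (w : G.Weights) (e : Fin G.m) : ℝ :=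
  if e ∈ F then (w e : ℝ) else 0

/-- The distance `d_w((F, w), (F', w'))` of two edge sets: the `ℓ₁` distance of their images under
the weighted mapping. -/
def dw (G : EdgeList) (F : Finset (Fin G.m)) (w : G.Weights)
    (F' : Finset (Fin G.m)) (w' : G.Weights) : ℝ :=
  ∑ e, |G.weightedVec F w e - G.weightedVec F' w' e|

/-- `D` is a coupling of the distributions `p` and `q`. -/
def IsCoupling {α : Type} (D : PMF (α × α)) (p q : PMF α) : Prop :=
  D.map Prod.fst = p ∧ D.map Prod.snd = q

/-- The earth mover's distance of two distributions over edge sets: the least expectation of `dw`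
over all couplings. -/
def earthMover (G : EdgeList) (p : PMF (Finset (Fin G.m))) (w : G.Weights)
    (q : PMF (Finset (Fin G.m))) (w' : G.Weights) : ℝ≥0∞ :=
  ⨅ (D : PMF (Finset (Fin G.m) × Finset (Fin G.m))) (_ : IsCoupling D p q),
    ∑ x, D x * ENNReal.ofReal (G.dw x.1 w x.2 w')

/-- The Lipschitz constant, on the graph `G`, of a randomized algorithm whose output on `(G, w)`
has the distribution `A w`. -/
def lipschitzConst (G : EdgeList) (A : G.Weights → PMF (Finset (Fin G.m))) : ℝ≥0∞ :=
  ⨆ (w : G.Weights) (w' : G.Weights) (_ : w ≠ w'),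
    G.earthMover (A w) w (A w') w' / ENNReal.ofReal (G.l1Dist w w')

/-- The size of the input `(G, w)`: number of vertices plus number of edges plus the lengths of
the binary exponents `⌈|log₂ w(e)|⌉` of the positive weights (a zero weight contributes `0`).  It is
at most of the order of the usual encoding length when the weights are rational. -/
def inputSize (G : EdgeList) (w : G.Weights) : ℕ :=
  G.n + G.m + ∑ e, ⌈|Real.logb 2 (w e : ℝ)|⌉₊

end EdgeList

/-- The output distributions of a randomized algorithm that maps a weighted graph to an edge
set. -/
abbrev OutputLaw : Type := (G : EdgeList) → G.Weights → PMF (Finset (Fin G.m))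

/-- A randomized `r`-approximation algorithm for maximum weight matching: it always returns a
matching, and the expected weight of that matching is at least `r` times the maximum. -/
def IsApproxMatching (r : ℝ) (A : OutputLaw) : Prop :=
  ∀ (G : EdgeList) (w : G.Weights),
    (∀ F ∈ (A G w).support, G.IsMatching F) ∧
      r * (G.opt w : ℝ) ≤ ∑ F, (A G w F).toReal * (G.weight w F : ℝ)

/-! ### The machine model

A randomized real RAM.  The memory consists of integer cells and real cells, both grouped into
arrays that are indexed by integers; there is no way to turn a real into an integer except through
comparisons.  The operations on integers are addition and (truncated) subtraction; those on reals
are addition, subtraction, multiplication by a rational constant of the program, and comparison;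
one instruction draws an independent uniform real from `[0, 1]`.  Registers are never multiplied,
so that unit cost for each operation is honest: no number can grow by more than a constant number
of bits in a step. -/

/-- Integer expressions. `cell a i` is the content of cell `i` of the integer array `a`. -/
inductive NExpr : Type
  | const (k : ℕ)
  | cell (a : ℕ) (i : NExpr)
  | add (x y : NExpr)
  | sub (x y : NExpr)

/-- Real expressions. `cell a i` is the content of cell `i` of the real array `a`. -/
inductive RExpr : Type
  | const (q : ℚ)
  | cell (a : ℕ) (i : NExpr)
  | add (x y : RExpr)
  | sub (x y : RExpr)
  | scale (q : ℚ) (x : RExpr)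

/-- Tests. -/
inductive BExpr : Type
  | leN (x y : NExpr)
  | leR (x y : RExpr)
  | neg (b : BExpr)
  | conj (b c : BExpr)

/-- Programs. `setN a i x` and `setR a i x` store the value of `x` in cell `i` of array `a`;
`sample a i` stores a fresh uniform random number from `[0, 1]` in cell `i` of the real array
`a`. -/
inductive Prog : Type
  | skip
  | setN (a : ℕ) (i x : NExpr)
  | setR (a : ℕ) (i : NExpr) (x : RExpr)
  | sample (a : ℕ) (i : NExpr)
  | seq (P Q : Prog)
  | ite (b : BExpr) (P Q : Prog)
  | loop (b : BExpr) (P : Prog)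

/-- A state of the machine: the two memories and the random numbers that are still unused. -/
structure State where
  nat : ℕ → ℕ → ℕ
  real : ℕ → ℕ → ℝ
  tape : ℕ → I

/-- Value of an integer expression. -/
def NExpr.eval (s : State) : NExpr → ℕ
  | .const k => k
  | .cell a i => s.nat a (i.eval s)
  | .add x y => x.eval s + y.eval s
  | .sub x y => x.eval s - y.eval s

/-- Number of operations in an integer expression. -/
def NExpr.cost : NExpr → ℕ
  | .const _ => 1
  | .cell _ i => 1 + i.cost
  | .add x y => 1 + x.cost + y.cost
  | .sub x y => 1 + x.cost + y.cost

/-- Value of a real expression. -/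
def RExpr.eval (s : State) : RExpr → ℝ
  | .const q => (q : ℝ)
  | .cell a i => s.real a (i.eval s)
  | .add x y => x.eval s + y.eval s
  | .sub x y => x.eval s - y.eval s
  | .scale q x => (q : ℝ) * x.eval s

/-- Number of operations in a real expression. -/
def RExpr.cost : RExpr → ℕ
  | .const _ => 1
  | .cell _ i => 1 + i.cost
  | .add x y => 1 + x.cost + y.cost
  | .sub x y => 1 + x.cost + y.cost
  | .scale _ x => 1 + x.cost

/-- Truth of a test. -/
def BExpr.holds (s : State) : BExpr → Prop
  | .leN x y => x.eval s ≤ y.eval s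
  | .leR x y => x.eval s ≤ y.eval s
  | .neg b => ¬ b.holds s
  | .conj b c => b.holds s ∧ c.holds s

/-- Number of operations in a test. -/
def BExpr.cost : BExpr → ℕ
  | .leN x y => 1 + x.cost + y.cost
  | .leR x y => 1 + x.cost + y.cost
  | .neg b => 1 + b.cost
  | .conj b c => 1 + b.cost + c.cost

/-- Overwrite cell `i` of array `a`. -/
def store {β : Type} (mem : ℕ → ℕ → β) (a i : ℕ) (v : β) : ℕ → ℕ → β :=
  Function.update mem a (Function.update (mem a) i v)

/-- `Exec P s t s'`: started in state `s`, the program `P` halts in state `s'` after `t` steps,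
where a step is an operation in an expression, a memory write, a random draw, a jump or a
`skip`. -/
inductive Exec : Prog → State → ℕ → State → Prop
  | skip (s : State) : Exec .skip s 1 s
  | setN (s : State) (a : ℕ) (i x : NExpr) :
      Exec (.setN a i x) s (1 + i.cost + x.cost)
        { s with nat := store s.nat a (i.eval s) (x.eval s) }
  | setR (s : State) (a : ℕ) (i : NExpr) (x : RExpr) :
      Exec (.setR a i x) s (1 + i.cost + x.cost)
        { s with real := store s.real a (i.eval s) (x.eval s) }
  | sample (s : State) (a : ℕ) (i : NExpr) :
      Exec (.sample a i) s (1 + i.cost)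
        { s with
          real := store s.real a (i.eval s) ((s.tape 0 : I) : ℝ)
          tape := fun k => s.tape (k + 1) }
  | seq {P Q : Prog} {s s₁ s₂ : State} {t₁ t₂ : ℕ} :
      Exec P s t₁ s₁ → Exec Q s₁ t₂ s₂ → Exec (.seq P Q) s (t₁ + t₂) s₂
  | ite_true {b : BExpr} {P Q : Prog} {s s' : State} {t : ℕ} :
      b.holds s → Exec P s t s' → Exec (.ite b P Q) s (1 + b.cost + t) s'
  | ite_false {b : BExpr} {P Q : Prog} {s s' : State} {t : ℕ} :
      ¬ b.holds s → Exec Q s t s' → Exec (.ite b P Q) s (1 + b.cost + t) s'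
  | loop_true {b : BExpr} {P : Prog} {s s₁ s₂ : State} {t₁ t₂ : ℕ} :
      b.holds s → Exec P s t₁ s₁ → Exec (.loop b P) s₁ t₂ s₂ →
        Exec (.loop b P) s (1 + b.cost + t₁ + t₂) s₂
  | loop_false {b : BExpr} {P : Prog} {s : State} :
      ¬ b.holds s → Exec (.loop b P) s (1 + b.cost) s

/-- The initial state on input `(G, w)` with random numbers `ω`.  Integer array `0` starts with the
numbers of vertices and edges, integer arrays `1` and `2` hold the endpoints of the edges, and real
array `0` holds their weights; every other cell is `0`. -/
def inputState (G : EdgeList) (w : G.Weights) (ω : ℕ → I) : State where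
  nat a i :=
    if a = 0 then (if i = 0 then G.n else if i = 1 then G.m else 0)
    else if a = 1 then (if h : i < G.m then (G.src ⟨i, h⟩ : ℕ) else 0)
    else if a = 2 then (if h : i < G.m then (G.tgt ⟨i, h⟩ : ℕ) else 0)
    else 0
  real a i := if a = 0 then (if h : i < G.m then (w ⟨i, h⟩ : ℝ) else 0) else 0
  tape := ω

/-- The edge set that a halting state represents: edge `e` is selected if cell `e` of integer array
`3` is not `0`. -/
def outputSet (G : EdgeList) (s : State) : Finset (Fin G.m) :=
  Finset.univ.filter fun e : Fin G.m => s.nat 3 e ≠ 0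

/-- On input `(G, w)` with random numbers `ω`, the program halts and returns the edge set `F`. -/
def Returns (P : Prog) (G : EdgeList) (w : G.Weights) (ω : ℕ → I) (F : Finset (Fin G.m)) : Prop :=
  ∃ t s', Exec P (inputState G w ω) t s' ∧ outputSet G s' = F

/-- The law of a sequence of independent random numbers, uniform on `[0, 1]`. -/
def uniformTape : Measure (ℕ → I) := Measure.infinitePi fun _ : ℕ => (volume : Measure I)

/-- `A G w` is the distribution of the output of `P` on `(G, w)`. -/
def HasOutputLaw (P : Prog) (A : OutputLaw) : Prop :=
  ∀ (G : EdgeList) (w : G.Weights) (F : Finset (Fin G.m)),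
    uniformTape {ω | Returns P G w ω F} = A G w F

/-- The program runs in polynomial time: on every input, and whatever the random numbers are, it
halts within a number of steps that is polynomial in the size of the input. -/
def PolyTime (P : Prog) : Prop :=
  ∃ p : Polynomial ℕ, ∀ (G : EdgeList) (w : G.Weights) (ω : ℕ → I),
    ∃ t s', Exec P (inputState G w ω) t s' ∧ t ≤ p.eval (G.inputSize w)

/-- Runs are deterministic once the random numbers are fixed. -/
theorem Exec.unique {P : Prog} {s s₁ s₂ : State} {t₁ t₂ : ℕ}
    (h₁ : Exec P s t₁ s₁) (h₂ : Exec P s t₂ s₂) : t₁ = t₂ ∧ s₁ = s₂ := by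
  induction h₁ generalizing t₂ s₂ with
  | skip | setN | setR | sample => cases h₂; exact ⟨rfl, rfl⟩
  | seq _ _ ih₁ ih₂ =>
    cases h₂ with
    | seq k₁ k₂ =>
      obtain ⟨rfl, rfl⟩ := ih₁ k₁
      obtain ⟨rfl, rfl⟩ := ih₂ k₂
      exact ⟨rfl, rfl⟩
  | ite_true hb _ ih =>
    cases h₂ with
    | ite_true _ k => obtain ⟨rfl, rfl⟩ := ih k; exact ⟨rfl, rfl⟩
    | ite_false hb' _ => exact absurd hb hb'
  | ite_false hb _ ih =>
    cases h₂ with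
    | ite_true hb' _ => exact absurd hb' hb
    | ite_false _ k => obtain ⟨rfl, rfl⟩ := ih k; exact ⟨rfl, rfl⟩
  | loop_true hb _ _ ih₁ ih₂ =>
    cases h₂ with
    | loop_true _ k₁ k₂ =>
      obtain ⟨rfl, rfl⟩ := ih₁ k₁
      obtain ⟨rfl, rfl⟩ := ih₂ k₂
      exact ⟨rfl, rfl⟩
    | loop_false hb' => exact absurd hb hb'
  | loop_false hb =>
    cases h₂ with
    | loop_true hb' _ _ => exact absurd hb' hb
    | loop_false _ => exact ⟨rfl, rfl⟩

end LipMatching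

end

/-! A single algorithm serves every ε: it is a 3/20-approximation with Lipschitz constant at most
21, and 3/20 > 1/8 while 21 ≤ 21/ε. A shift `x`, uniform in [1, 4], is drawn and each positive
weight is rounded down to the grid of the numbers `x * 4 ^ i`. Edges with equal rounded weight form
a class. Inside each class a greedy matching is built in the order of independent uniform ranks;
then the union of these matchings is thinned greedily from larger to smaller classes.

Approximation. Inside its class an edge of an optimal matching meets a class-matching edge of the
same rounded weight, and each of the latter is met by at most two of the former, which costs a
factor 2. In the thinning, a discarded edge is charged to an adjacent selected edge of larger
rounded weight. At each endpoint of that edge the charges have distinct values that decay by factors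
of 4, so together they are at most 2/3 of it, which costs a factor 5/3 (`sum_matching_le_select`).
Rounding keeps at least half of a weight in expectation (`half_le_rdMean`), and 1/2 · 3/10 = 3/20.

Lipschitz continuity. Both runs use the same tape, and weights are changed one edge `e` at a time.
If the rounded weight of `e` stays the same, so does the output. Otherwise both outputs are compared
with the output after deletion of `e`. Three facts bound the cost. Deleting an element from a
random-order greedy selection changes at most one element on average
(`sum_card_symmDiff_greedy_delete_le`), and all changes stay in the class of `e`. The thinning
amplifies a change of rounded weight at most threefold (`sum_symmDiff_levelSel_le`). The expected
change of the rounded weight of `e` is at most the change of its weight (`rdMean_sub_le`).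

The average influence is bounded by an exchange argument. Let `P` be the set of elements on which
"`e` first" and "`e` deleted" disagree. Exchanging the rank of `e` with the next larger rank in `P`
preserves `P`. So, for given `P`, the event that `e` has the least rank in `P` has at most a 1/|P|
share of the permutations, and only in that event can the deletion matter, with effect |P|.

The program needs no sorting: it recomputes all statuses `2m` times, and each sweep settles one more
position of the greedy orders. -/

noncomputable section

namespace LipMatching

/-! ### Greedy selection along a well-founded blocking relation -/

section Greedy

variable {ι : Type}

/-- `S` is the outcome of the greedy selection among the elements satisfying `p`, where a selected
element `y` blocks every `x` with `R y x`. -/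
def IsGreedy (p : ι → Prop) (R : ι → ι → Prop) (S : Finset ι) : Prop :=
  ∀ x, x ∈ S ↔ p x ∧ ∀ y, R y x → y ∉ S

theorem IsGreedy.unique {p : ι → Prop} {R : ι → ι → Prop} (hR : WellFounded R) {S T : Finset ι}
    (hS : IsGreedy p R S) (hT : IsGreedy p R T) : S = T := by
  ext x
  induction x using hR.induction with
  | _ x ih =>
    rw [hS x, hT x]
    exact and_congr_right fun _ => forall₂_congr fun y hy => not_congr (ih y hy)

open Classical in
theorem exists_isGreedy [Fintype ι] (p : ι → Prop) {R : ι → ι → Prop} (hR : WellFounded R) :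
    ∃ S, IsGreedy p R S := by
  let F : ι → Prop := hR.fix (C := fun _ => Prop) fun x ih => p x ∧ ∀ y (h : R y x), ¬ ih y h
  refine ⟨Finset.univ.filter F, fun x => ?_⟩
  simp only [Finset.mem_filter, Finset.mem_univ, true_and]
  exact (hR.fix_eq (C := fun _ => Prop) (fun x ih => p x ∧ ∀ y (h : R y x), ¬ ih y h) x).to_iff

open Classical in
/-- The outcome of the greedy selection. -/
def greedy [Fintype ι] (p : ι → Prop) (R : ι → ι → Prop) : Finset ι :=
  if h : ∃ S, IsGreedy p R S then h.choose else ∅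

theorem isGreedy_greedy [Fintype ι] (p : ι → Prop) {R : ι → ι → Prop} (hR : WellFounded R) :
    IsGreedy p R (greedy p R) := by
  have h := exists_isGreedy p hR
  rw [greedy, dif_pos h]
  exact h.choose_spec

/-- Blocking along the conflict relation `H` by elements of smaller rank. -/
def rankBlock (H : ι → ι → Prop) (r : ι → ℝ) (y x : ι) : Prop := H y x ∧ r y < r x

theorem wellFounded_of_rank [Finite ι] {R : ι → ι → Prop} (r : ι → ℝ) (h : ∀ y x, R y x → r y < r x) :
    WellFounded R := by
  have : IsStrictOrder ι (fun a b => r a < r b) :=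
    { irrefl := fun a => lt_irrefl (r a), trans := fun _ _ _ => lt_trans }
  exact Subrelation.wf (fun {a b} hab => h a b hab)
    (Finite.wellFounded_of_trans_of_irrefl (fun a b => r a < r b))

theorem wellFounded_rankBlock [Finite ι] (H : ι → ι → Prop) (r : ι → ℝ) : WellFounded (rankBlock H r) :=
  wellFounded_of_rank r fun _ _ h => h.2

/-- The greedy condition away from `e`, for a selection in which `e` takes precedence over all other
elements. -/
def IsGreedyAround (H : ι → ι → Prop) (r : ι → ℝ) (e : ι) (M : Finset ι) : Prop :=
  ∀ x, x ≠ e → (x ∈ M ↔ ∀ y, H y x → (y = e ∨ r y < r x) → y ∉ M)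

/-- `IsGreedyAround` leaves the status of `e` free, so it covers both "`e` first" and "`e` deleted".
Once that status is fixed, induction on the rank determines the rest. -/
theorem IsGreedyAround.unique [Finite ι] {H : ι → ι → Prop} {r : ι → ℝ} {e : ι} {M N : Finset ι}
    (hM : IsGreedyAround H r e M) (hN : IsGreedyAround H r e N) (he : e ∈ M ↔ e ∈ N) : M = N := by
  ext x
  induction x using (wellFounded_of_rank (R := fun a b => r a < r b) r fun _ _ h => h).induction with
  | _ x ih =>
    by_cases hx : x = e
    · rw [hx, he]
    · rw [hM x hx, hN x hx]
      refine forall₂_congr fun y _ => ?_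
      constructor <;> rintro h (rfl | hy)
      · exact fun h' => h (Or.inl rfl) (he.2 h')
      · exact fun h' => h (Or.inr hy) ((ih y hy).2 h')
      · exact fun h' => h (Or.inl rfl) (he.1 h')
      · exact fun h' => h (Or.inr hy) ((ih y hy).1 h')

theorem isGreedyAround_of_not_mem {H : ι → ι → Prop} {r : ι → ℝ} {e : ι} {M : Finset ι}
    (hM : IsGreedy (· ≠ e) (rankBlock H r) M) : e ∉ M ∧ IsGreedyAround H r e M := by
  have he : e ∉ M := fun h => ((hM e).1 h).1 rfl
  refine ⟨he, fun x hx => ?_⟩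
  rw [hM x]
  constructor
  · rintro ⟨_, h⟩ y hy (rfl | hlt)
    · exact he
    · exact h y ⟨hy, hlt⟩
  · exact fun h => ⟨hx, fun y hy => h y hy.1 (Or.inr hy.2)⟩

/-- If `e` is selected at its own rank, none of its neighbours is selected, so promoting it to the
front excludes nothing new. -/
theorem isGreedyAround_of_mem {H : ι → ι → Prop} (hs : ∀ x y, H x y → H y x) {r : ι → ℝ}
    (hr : Function.Injective r) {e : ι} {M : Finset ι}
    (hM : IsGreedy (fun _ => True) (rankBlock H r) M) (he : e ∈ M) : IsGreedyAround H r e M := by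
  intro x hx
  constructor
  · rintro h y hy (rfl | hlt) hyM
    · rcases lt_or_gt_of_ne (hr.ne hx) with h' | h'
      · exact ((hM y).1 hyM).2 x ⟨hs _ _ hy, h'⟩ h
      · exact ((hM x).1 h).2 y ⟨hy, h'⟩ hyM
    · exact ((hM x).1 h).2 y ⟨hy, hlt⟩ hyM
  · exact fun h => (hM x).2 ⟨trivial, fun y hy => h y hy.1 (Or.inr hy.2)⟩

theorem exists_isGreedyAround_mem [Fintype ι] [DecidableEq ι] (H : ι → ι → Prop)
    (r : ι → ℝ) (e : ι) : ∃ M, e ∈ M ∧ IsGreedyAround H r e M := by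
  let R : ι → ι → Prop := fun y x => x ≠ e ∧ H y x ∧ (y = e ∨ r y < r x)
  have hR : WellFounded R := by
    obtain ⟨b, hb⟩ := (Set.finite_range r).bddBelow
    -- Nothing blocks `e` under `R`, so it may be ranked below the lower bound `b` of all ranks.
    refine wellFounded_of_rank (Function.update r e (b - 1)) ?_
    rintro y x ⟨hx, _, rfl | hlt⟩
    · have := hb ⟨x, rfl⟩
      simp only [Function.update_self, Function.update_of_ne hx]
      linarith
    · rw [Function.update_of_ne hx]
      by_cases hy : y = e
      · subst hy
        have := hb ⟨x, rfl⟩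
        rw [Function.update_self]; linarith
      · rwa [Function.update_of_ne hy]
  obtain ⟨M, hM⟩ := exists_isGreedy (fun _ => True) hR
  refine ⟨M, (hM e).2 ⟨trivial, fun y hy => absurd rfl hy.1⟩, fun x hx => ?_⟩
  rw [hM x]
  simp only [true_and]
  exact ⟨fun h y h1 h2 => h y ⟨hx, h1, h2⟩, fun h y h1 => h y h1.2.1 h1.2.2⟩

theorem IsGreedyAround.independent {H : ι → ι → Prop} (hs : ∀ x y, H x y → H y x)
    (hi : ∀ x, ¬ H x x) {r : ι → ℝ} (hr : Function.Injective r) {e : ι} {M : Finset ι}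
    (hM : IsGreedyAround H r e M) {x y : ι} (hx : x ∈ M) (hy : y ∈ M) : ¬ H x y := by
  intro h
  have hne : x ≠ y := by rintro rfl; exact hi _ h
  by_cases hxe : x = e
  · subst hxe
    exact (hM y hne.symm).1 hy x h (Or.inl rfl) hx
  by_cases hye : y = e
  · subst hye
    exact (hM x hxe).1 hx y (hs _ _ h) (Or.inl rfl) hy
  rcases lt_or_gt_of_ne (hr.ne hne) with hlt | hlt
  · exact (hM y hye).1 hy x h (Or.inr hlt) hx
  · exact (hM x hxe).1 hx y (hs _ _ h) (Or.inr hlt) hy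

/-- Exchanging the ranks of `e` and of its successor `p` in a set that contains all places where two
selections differ keeps each of them greedy away from `e`. -/
theorem IsGreedyAround.swap [DecidableEq ι] {H : ι → ι → Prop} (hs : ∀ x y, H x y → H y x)
    (hi : ∀ x, ¬ H x x) {r : ι → ℝ} (hr : Function.Injective r) {e p : ι} {M N : Finset ι}
    (hM : IsGreedyAround H r e M) (hN : IsGreedyAround H r e N) (hpM : p ∈ symmDiff M N)
    (hpe : p ≠ e) (hlt : r e < r p)
    (hsucc : ∀ q ∈ symmDiff M N, r e < r q → r p ≤ r q) :
    IsGreedyAround H (r ∘ Equiv.swap e p) e M := by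
  have hle : ∀ y, y ≠ e → (r ∘ Equiv.swap e p) y ≤ r y := by
    intro y hy
    by_cases hyp : y = p
    · subst hyp; simp [hlt.le]
    · simp [Equiv.swap_apply_of_ne_of_ne hy hyp]
  intro x hx
  constructor
  -- `M` is independent, so this direction does not see the ranks.
  · intro h y hy _ hyM
    exact hM.independent hs hi hr hyM h hy
  · intro h
    by_contra hxM
    have h1 := mt (hM x hx).2 hxM
    push Not at h1
    obtain ⟨y, hyx, hy, hyM⟩ := h1
    rcases hy with rfl | hy
    · exact h y hyx (Or.inl rfl) hyM
    by_cases hye : y = e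
    · exact h y hyx (Or.inl hye) hyM
    refine h y hyx (Or.inr ?_) hyM
    -- Apart from `e`, only `p` changes rank, and it moves down. So a blocker keeps blocking unless
    -- the blocked element is `p` itself. In that case `p ∈ N` forces `y ∉ N`, so `y` lies in the
    -- difference of `M` and `N`, and being below `p` it is already below `e`.
    by_cases hxp : x = p
    · subst hxp
      have hxN : x ∈ N := by
        rcases Finset.mem_symmDiff.1 hpM with h' | h'
        · exact absurd h'.1 hxM
        · exact h'.1
      have hyN : y ∉ N := fun h' => hN.independent hs hi hr h' hxN hyx
      have hyP : y ∈ symmDiff M N := Finset.mem_symmDiff.2 (Or.inl ⟨hyM, hyN⟩)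
      have hye' : r y < r e := by
        rcases lt_or_gt_of_ne (hr.ne hye) with h' | h'
        · exact h'
        · exact absurd hy (not_lt.2 (hsucc y hyP h'))
      have hyx' : y ≠ x := by rintro rfl; exact hi _ hyx
      simpa [Equiv.swap_apply_of_ne_of_ne hye hyx'] using hye'
    · calc (r ∘ Equiv.swap e p) y ≤ r y := hle y hye
        _ < r x := hy
        _ = (r ∘ Equiv.swap e p) x := by simp [Equiv.swap_apply_of_ne_of_ne hx hxp]

/-! ### The average influence of one element on a random-order greedy selection -/

variable [Fintype ι] [DecidableEq ι]

/-- The elements whose selection depends on whether `e` is put first or deleted. -/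
def potentialInfluence (H : ι → ι → Prop) (r : ι → ℝ) (e : ι) : Finset ι :=
  symmDiff (exists_isGreedyAround_mem H r e).choose (greedy (· ≠ e) (rankBlock H r))

theorem potentialInfluence_eq {H : ι → ι → Prop} {r : ι → ℝ} {e : ι} {M N : Finset ι}
    (hM : IsGreedyAround H r e M) (hN : IsGreedyAround H r e N) (heM : e ∈ M) (heN : e ∉ N) :
    potentialInfluence H r e = symmDiff M N := by
  have h1 := (exists_isGreedyAround_mem H r e).choose_spec
  have h2 := isGreedyAround_of_not_mem (isGreedy_greedy (· ≠ e) (wellFounded_rankBlock H r))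
  rw [potentialInfluence, h1.2.unique hM (by simp [h1.1, heM]),
    h2.2.unique hN (by simp [h2.1, heN])]

theorem potentialInfluence_swap {H : ι → ι → Prop} (hs : ∀ x y, H x y → H y x)
    (hi : ∀ x, ¬ H x x) {r : ι → ℝ} (hr : Function.Injective r) {e p : ι}
    (hp : p ∈ potentialInfluence H r e) (hlt : r e < r p)
    (hsucc : ∀ q ∈ potentialInfluence H r e, r e < r q → r p ≤ r q) :
    potentialInfluence H (r ∘ Equiv.swap e p) e = potentialInfluence H r e := by
  have h1 := (exists_isGreedyAround_mem H r e).choose_spec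
  have h2 := isGreedyAround_of_not_mem (isGreedy_greedy (· ≠ e) (wellFounded_rankBlock H r))
  have hpe : p ≠ e := by rintro rfl; exact lt_irrefl _ hlt
  refine potentialInfluence_eq (h1.2.swap hs hi hr h2.2 hp hpe hlt hsucc)
    (h2.2.swap hs hi hr h1.2 ?_ hpe hlt ?_) h1.1 h2.1
  · rw [symmDiff_comm]; exact hp
  · rw [symmDiff_comm]; exact hsucc

/-- The elements of `potentialInfluence` of smaller rank than `e`. -/
def influenceBelow (H : ι → ι → Prop) (r : ι → ℝ) (e : ι) : Finset ι :=
  (potentialInfluence H r e).filter fun q => r q < r e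

/-- The elements whose selection changes when `e` is deleted are none at all, or those of
`potentialInfluence`; in the latter case `e` has the least rank among them. -/
theorem symmDiff_greedy_delete {H : ι → ι → Prop} (hs : ∀ x y, H x y → H y x)
    {r : ι → ℝ} (hr : Function.Injective r) (e : ι) :
    symmDiff (greedy (fun _ => True) (rankBlock H r)) (greedy (· ≠ e) (rankBlock H r)) = ∅ ∨
    (symmDiff (greedy (fun _ => True) (rankBlock H r)) (greedy (· ≠ e) (rankBlock H r)) =
      potentialInfluence H r e ∧ influenceBelow H r e = ∅) := by
  have hwf := wellFounded_rankBlock H r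
  have hA := isGreedy_greedy (fun _ => True) hwf
  have hD := isGreedy_greedy (· ≠ e) hwf
  set A := greedy (fun _ => True) (rankBlock H r)
  set D := greedy (· ≠ e) (rankBlock H r)
  have hD' := isGreedyAround_of_not_mem hD
  by_cases he : e ∈ A
  · right
    have hEq := potentialInfluence_eq (isGreedyAround_of_mem hs hr hA he) hD'.2 he hD'.1
    refine ⟨hEq.symm, ?_⟩
    -- Elements ranked below `e` are never blocked by `e`, hence lie outside the difference.
    have key : ∀ x, r x < r e → (x ∈ A ↔ x ∈ D) := by
      intro x
      induction x using hwf.induction with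
      | _ x ih =>
        intro hx
        rw [hA x, hD x]
        have hxe : x ≠ e := by rintro rfl; exact lt_irrefl _ hx
        simp only [true_and, hxe, ne_eq, not_false_eq_true]
        exact forall₂_congr fun y hy => not_congr (ih y hy (hy.2.trans hx))
    rw [influenceBelow, hEq, Finset.filter_eq_empty_iff]
    intro q hq hlt
    rw [Finset.mem_symmDiff, key q hlt] at hq
    tauto
  · left
    have hA' : IsGreedy (· ≠ e) (rankBlock H r) A := by
      intro x
      by_cases hx : x = e
      · subst hx; simp [he]
      · rw [hA x]; simp [hx]
    rw [hA'.unique hwf hD]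
    exact symmDiff_self _

open Classical in
/-- The rank permutations for which the potential influence is `P`, with `j` elements below `e`. -/
def influenceEvent (H : ι → ι → Prop) (r : ι → ℝ) (e : ι) (P : Finset ι) (j : ℕ) :
    Finset (Equiv.Perm ι) :=
  Finset.univ.filter fun π =>
    potentialInfluence H (r ∘ π) e = P ∧ (influenceBelow H (r ∘ π) e).card = j

/-- Composing `π` with the transposition of `e` and its successor `s π` in `P` preserves `P`, adds
exactly `s π` to the elements below `e`, and is injective. -/
theorem card_influenceEvent_succ {H : ι → ι → Prop} (hs : ∀ x y, H x y → H y x)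
    (hi : ∀ x, ¬ H x x) {r : ι → ℝ} (hr : Function.Injective r) (e : ι) (P : Finset ι) {j : ℕ}
    (hj : j + 1 < P.card) :
    (influenceEvent H r e P j).card ≤ (influenceEvent H r e P (j + 1)).card := by
  classical
  have hsucc : ∀ π ∈ influenceEvent H r e P j, ∃ p ∈ P, r (π e) < r (π p) ∧
      ∀ q ∈ P, r (π e) < r (π q) → r (π p) ≤ r (π q) := by
    intro π hπ
    obtain ⟨hP, hc⟩ := (Finset.mem_filter.1 hπ).2
    -- Otherwise `P` would consist of at most `e` and the `j` elements below it, contrary to `j + 1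
    -- < P.card`.
    have hne : (P.filter fun q => r (π e) < r (π q)).Nonempty := by
      by_contra hem
      rw [Finset.not_nonempty_iff_eq_empty, Finset.filter_eq_empty_iff] at hem
      have : P ⊆ insert e (influenceBelow H (r ∘ π) e) := by
        intro q hq
        rw [Finset.mem_insert]
        by_cases hqe : q = e
        · exact Or.inl hqe
        · right
          refine Finset.mem_filter.2 ⟨hP ▸ hq, ?_⟩
          exact lt_of_le_of_ne (not_lt.1 (hem hq)) ((hr.comp π.injective).ne hqe)
      have := (Finset.card_le_card this).trans (Finset.card_insert_le _ _)
      omega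
    obtain ⟨p, hp, hmin⟩ := Finset.exists_min_image _ (fun q => r (π q)) hne
    rw [Finset.mem_filter] at hp
    exact ⟨p, hp.1, hp.2, fun q hq h => hmin q (Finset.mem_filter.2 ⟨hq, h⟩)⟩
  have : Nonempty ι := ⟨e⟩
  choose! s hsP hsl hsm using hsucc
  refine Finset.card_le_card_of_injOn (fun π => π * Equiv.swap e (s π)) ?_ ?_
  · intro π hπ
    obtain ⟨hP, hc⟩ := (Finset.mem_filter.1 hπ).2
    have hse : s π ≠ e := by
      intro h
      have := hsl π hπ
      rw [h] at this
      exact lt_irrefl _ this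
    have hpi : potentialInfluence H (r ∘ ⇑(π * Equiv.swap e (s π))) e = P := by
      rw [← hP]
      refine potentialInfluence_swap (r := r ∘ π) hs hi (hr.comp π.injective) ?_ (hsl π hπ) ?_
      · rw [hP]; exact hsP π hπ
      · rw [hP]; exact hsm π hπ
    refine Finset.mem_coe.2 (Finset.mem_filter.2 ⟨Finset.mem_univ _, hpi, ?_⟩)
    have hbelow : influenceBelow H (r ∘ ⇑(π * Equiv.swap e (s π))) e =
        insert (s π) (influenceBelow H (r ∘ π) e) := by
      ext q
      rw [influenceBelow, influenceBelow, hpi, hP]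
      simp only [Finset.mem_filter, Finset.mem_insert, Function.comp_apply, Equiv.Perm.coe_mul,
        Equiv.swap_apply_left]
      by_cases hqs : q = s π
      · subst hqs
        simp [hsP π hπ, hsl π hπ]
      by_cases hqe : q = e
      · subst hqe
        simp [hse.symm]
      rw [Equiv.swap_apply_of_ne_of_ne hqe hqs]
      simp only [hqs, false_or, and_congr_right_iff]
      intro hq
      constructor
      · intro h
        rcases lt_or_gt_of_ne ((hr.comp π.injective).ne hqe) with h' | h'
        · exact h'
        · exact absurd h (not_lt.2 (hsm π hπ q hq h'))
      · intro h; exact h.trans (hsl π hπ)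
    rw [hbelow, Finset.card_insert_of_notMem, hc]
    intro h
    exact lt_asymm (Finset.mem_filter.1 h).2 (hsl π hπ)
  · intro π hπ τ hτ hπτ
    have hπ' := hsl π hπ
    have hτ' := hsl τ hτ
    have key : ∀ x, π (Equiv.swap e (s π) x) = τ (Equiv.swap e (s τ) x) := fun x =>
      congrArg (fun f : Equiv.Perm ι => f x) hπτ
    by_cases h : s π = s τ
    · simp only [h] at hπτ
      exact mul_right_cancel hπτ
    exfalso
    have hπe : s π ≠ e := by intro h; rw [h] at hπ'; exact lt_irrefl _ hπ'
    have hτe : s τ ≠ e := by intro h; rw [h] at hτ'; exact lt_irrefl _ hτ'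
    have k1 := key e
    have k2 := key (s π)
    have k3 := key (s τ)
    simp only [Equiv.swap_apply_left, Equiv.swap_apply_right] at k1 k2 k3
    rw [Equiv.swap_apply_of_ne_of_ne hπe h] at k2
    rw [Equiv.swap_apply_of_ne_of_ne hτe (Ne.symm h)] at k3
    -- `k1 : π (s π) = τ (s τ)`, `k2 : π e = τ (s π)`, `k3 : π (s τ) = τ e`
    have a1 : r (π (s π)) ≤ r (π (s τ)) ∨ r (π (s τ)) < r (π e) := by
      rcases lt_or_ge (r (π e)) (r (π (s τ))) with h' | h'
      · exact Or.inl (hsm π hπ _ (hsP τ hτ) h')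
      · right
        exact lt_of_le_of_ne h' ((hr.comp π.injective).ne hτe)
    have a2 : r (τ (s τ)) ≤ r (τ (s π)) ∨ r (τ (s π)) < r (τ e) := by
      rcases lt_or_ge (r (τ e)) (r (τ (s π))) with h' | h'
      · exact Or.inl (hsm τ hτ _ (hsP π hπ) h')
      · right
        exact lt_of_le_of_ne h' ((hr.comp τ.injective).ne hπe)
    rw [k1, k3] at a1
    rw [← k2] at a2
    rw [k2] at hπ' a1 a2
    rw [k1] at hπ'
    rcases a1 with a1 | a1 <;> rcases a2 with a2 | a2 <;> linarith

/-- By monotonicity in `j`, the event `j = 0` is no larger than any of the |P| disjoint events for a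
given `P`. A deletion has an effect only in that event, where the effect is |P|; summing over `P`
counts each permutation at most once. -/
theorem sum_card_symmDiff_greedy_delete_le {H : ι → ι → Prop} (hs : ∀ x y, H x y → H y x)
    (hi : ∀ x, ¬ H x x) {r : ι → ℝ} (hr : Function.Injective r) (e : ι) :
    ∑ π : Equiv.Perm ι, (symmDiff (greedy (fun _ => True) (rankBlock H (r ∘ π)))
      (greedy (· ≠ e) (rankBlock H (r ∘ π)))).card ≤ Fintype.card (Equiv.Perm ι) := by
  classical
  have h0 : ∀ (P : Finset ι) (j : ℕ), j < P.card →
      (influenceEvent H r e P 0).card ≤ (influenceEvent H r e P j).card := by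
    intro P j
    induction j with
    | zero => exact fun _ => le_rfl
    | succ j ih =>
      exact fun h => (ih (by omega)).trans (card_influenceEvent_succ hs hi hr e P h)
  have h1 : ∀ P : Finset ι, P.card * (influenceEvent H r e P 0).card ≤
      (Finset.univ.filter fun π : Equiv.Perm ι => potentialInfluence H (r ∘ π) e = P).card := by
    intro P
    calc P.card * (influenceEvent H r e P 0).card
        = ∑ _j ∈ Finset.range P.card, (influenceEvent H r e P 0).card := by simp
      _ ≤ ∑ j ∈ Finset.range P.card, (influenceEvent H r e P j).card :=
          Finset.sum_le_sum fun j hj => h0 P j (Finset.mem_range.1 hj)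
      _ = ((Finset.range P.card).biUnion fun j => influenceEvent H r e P j).card := by
          rw [Finset.card_biUnion]
          intro i _ j _ hij
          refine Finset.disjoint_left.2 fun π h1 h2 => hij ?_
          rw [← (Finset.mem_filter.1 h1).2.2, ← (Finset.mem_filter.1 h2).2.2]
      _ ≤ _ := by
          refine Finset.card_le_card fun π hπ => ?_
          obtain ⟨j, _, hj⟩ := Finset.mem_biUnion.1 hπ
          exact Finset.mem_filter.2 ⟨Finset.mem_univ _, (Finset.mem_filter.1 hj).2.1⟩
  calc ∑ π : Equiv.Perm ι, (symmDiff (greedy (fun _ => True) (rankBlock H (r ∘ π)))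
        (greedy (· ≠ e) (rankBlock H (r ∘ π)))).card
      ≤ ∑ π : Equiv.Perm ι, ∑ P : Finset ι,
          if π ∈ influenceEvent H r e P 0 then P.card else 0 := by
        refine Finset.sum_le_sum fun π _ => ?_
        rcases symmDiff_greedy_delete hs (hr.comp π.injective) e with h | ⟨h, h'⟩
        · rw [h]; simp
        · rw [h]
          refine le_trans ?_ (Finset.single_le_sum (fun _ _ => Nat.zero_le _)
            (Finset.mem_univ (potentialInfluence H (r ∘ π) e)))
          rw [if_pos]
          exact Finset.mem_filter.2 ⟨Finset.mem_univ _, rfl, by rw [h', Finset.card_empty]⟩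
    _ = ∑ P : Finset ι, P.card * (influenceEvent H r e P 0).card := by
        rw [Finset.sum_comm]
        refine Finset.sum_congr rfl fun P _ => ?_
        rw [← Finset.sum_filter, Finset.sum_const, smul_eq_mul, mul_comm]
        congr 2
        ext π; simp
    _ ≤ ∑ P : Finset ι, (Finset.univ.filter fun π : Equiv.Perm ι =>
          potentialInfluence H (r ∘ π) e = P).card := Finset.sum_le_sum fun P _ => h1 P
    _ = Fintype.card (Equiv.Perm ι) := by
        rw [← Finset.card_univ, Finset.card_eq_sum_card_fiberwise (t := Finset.univ)
          (f := fun π : Equiv.Perm ι => potentialInfluence H (r ∘ π) e) (by simp)]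

end Greedy

/-! ### Two-level greedy matchings -/

/-- Values of which each is at least four times every smaller one. -/
def Separated {ι : Type} (c : ι → ℝ) : Prop := ∀ x y, c x < c y → 4 * c x ≤ c y

/-- The geometric series t/4 + t/16 + … = t/3: the values below the largest value `a` sum to at most
a/3, and 4a/3 ≤ t/3. -/
theorem Separated.sum_le {ι : Type} {c : ι → ℝ} (hc : Separated c) (T : Finset ι)
    (hinj : Set.InjOn c T) {t : ℝ} (ht0 : 0 ≤ t) (ht : ∀ x ∈ T, 4 * c x ≤ t) :
    ∑ x ∈ T, c x ≤ t / 3 := by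
  classical
  induction T using Finset.induction_on_max_value c generalizing t with
  | empty => simp; positivity
  | insert a s ha hmax ih =>
    rw [Finset.sum_insert ha]
    have hlt : ∀ x ∈ s, 4 * c x ≤ c a := fun x hx =>
      hc x a (lt_of_le_of_ne (hmax x hx) fun h => ha (by
        have := hinj (Finset.mem_coe.2 (Finset.mem_insert_of_mem hx))
          (Finset.mem_coe.2 (Finset.mem_insert_self a s)) h
        exact this ▸ hx))
    have hat := ht a (Finset.mem_insert_self a s)
    by_cases h0 : 0 ≤ c a
    · have := ih (hinj.mono (by simp)) h0 hlt
      linarith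
    · have : ∑ x ∈ s, c x ≤ 0 := Finset.sum_nonpos fun x hx => by
        have := hmax x hx
        linarith [not_le.1 h0]
      linarith [not_le.1 h0]

namespace EdgeList

variable (G : EdgeList)

/-- Two distinct edges with a common endpoint. -/
def Adj (f e : Fin G.m) : Prop := f ≠ e ∧ ¬ Disjoint (G.ends f) (G.ends e)

variable {G}

theorem Adj.symm {e f : Fin G.m} (h : G.Adj e f) : G.Adj f e :=
  ⟨h.1.symm, fun h' => h.2 h'.symm⟩

theorem Adj.exists_mem_ends {e f : Fin G.m} (h : G.Adj e f) :
    ∃ v ∈ G.ends f, v ∈ G.ends e := by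
  obtain ⟨v, h1, h2⟩ := Finset.not_disjoint_iff.1 h.2
  exact ⟨v, h2, h1⟩

theorem card_ends (e : Fin G.m) : (G.ends e).card = 2 := Finset.card_pair (G.loopless e)

variable (G) in
/-- No two adjacent edges of `A` have the same value of `c`. -/
def ClassMatching (c : Fin G.m → ℝ) (A : Finset (Fin G.m)) : Prop :=
  ∀ e ∈ A, ∀ f ∈ A, G.Adj e f → c e ≠ c f

/-- If every edge of `X` has an adjacent edge of larger value in `Y`, then the total value of `X` is
at most two thirds of that of `Y`. -/
theorem ClassMatching.sum_le_of_adj {c : Fin G.m → ℝ} (hc : Separated c) (h0 : ∀ e, 0 ≤ c e)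
    {X Y : Finset (Fin G.m)} (hX : G.ClassMatching c X)
    (hXY : ∀ f ∈ X, ∃ g ∈ Y, G.Adj g f ∧ c f < c g) :
    ∑ f ∈ X, c f ≤ 2 / 3 * ∑ g ∈ Y, c g := by
  classical
  choose! g hgY hadj hlt using hXY
  rw [← Finset.sum_fiberwise_of_maps_to hgY, Finset.mul_sum]
  refine Finset.sum_le_sum fun y _ => ?_
  -- Distinct edges of `X` through a common vertex are adjacent, so their values are distinct, and
  -- each is at most a quarter of `c y`. The two endpoints of `y` then give the factor 2/3.
  have hstar : ∀ v, ∑ f ∈ (X.filter fun f => g f = y).filter (fun f => v ∈ G.ends f), c f ≤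
      c y / 3 := by
    intro v
    refine hc.sum_le _ ?_ (h0 y) ?_
    · intro e he f hf hef
      by_contra hne
      simp only [Finset.coe_filter, Set.mem_ofPred_eq, Finset.mem_filter] at he hf
      exact hX e he.1.1 f hf.1.1 ⟨hne, Finset.not_disjoint_iff.2 ⟨v, he.2, hf.2⟩⟩ hef
    · intro f hf
      simp only [Finset.mem_filter] at hf
      have := hlt f hf.1.1
      rw [hf.1.2] at this
      exact hc f y this
  calc ∑ f ∈ X.filter (fun f => g f = y), c f
      ≤ ∑ f ∈ X.filter (fun f => g f = y), ∑ v ∈ G.ends y, if v ∈ G.ends f then c f else 0 := by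
        refine Finset.sum_le_sum fun f hf => ?_
        simp only [Finset.mem_filter] at hf
        have := hadj f hf.1
        rw [hf.2] at this
        obtain ⟨v, hvf, hvy⟩ := this.exists_mem_ends
        refine le_trans (by simp [hvf]) (Finset.single_le_sum (f := fun v =>
          if v ∈ G.ends f then c f else 0) (fun w _ => ?_) hvy)
        positivity [h0 f]
    _ = ∑ v ∈ G.ends y, ∑ f ∈ (X.filter fun f => g f = y).filter (fun f => v ∈ G.ends f), c f := by
        rw [Finset.sum_comm]
        exact Finset.sum_congr rfl fun v _ => (Finset.sum_filter _ _).symm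
    _ ≤ ∑ _v ∈ G.ends y, c y / 3 := Finset.sum_le_sum fun v _ => hstar v
    _ = 2 / 3 * c y := by rw [Finset.sum_const, card_ends]; simp; ring

/-! ### The class selection, the level selection and their approximation ratio -/

variable (G)

/-- The processing order: by rank, ties are broken by the index. -/
def before (r : Fin G.m → ℝ) (f e : Fin G.m) : Prop := r f < r e ∨ (r f ≤ r e ∧ f < e)

/-- Blocking inside the classes of edges with equal `c`. -/
def classBlock (c r : Fin G.m → ℝ) (f e : Fin G.m) : Prop :=
  (G.Adj f e ∧ c f = c e) ∧ G.before r f e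

/-- Blocking by edges of larger `c`. -/
def levelBlock (c : Fin G.m → ℝ) (f e : Fin G.m) : Prop := G.Adj f e ∧ c e < c f

/-- The union of the greedy matchings of the classes. -/
def classSel (c r : Fin G.m → ℝ) : Finset (Fin G.m) := greedy (fun _ => True) (G.classBlock c r)

/-- The union of the greedy matchings of the classes, after the deletion of `e`. -/
def classSelDel (c r : Fin G.m → ℝ) (e : Fin G.m) : Finset (Fin G.m) :=
  greedy (· ≠ e) (G.classBlock c r)

/-- The greedy matching in `A`, by decreasing `c`. -/
def levelSel (c : Fin G.m → ℝ) (A : Finset (Fin G.m)) : Finset (Fin G.m) :=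
  greedy (· ∈ A) (G.levelBlock c)

/-- The output of the algorithm for rounded weights `c` and ranks `r`. -/
def select (c r : Fin G.m → ℝ) : Finset (Fin G.m) := G.levelSel c (G.classSel c r)

variable {G}

theorem before_iff {r : Fin G.m → ℝ} {f e : Fin G.m} :
    G.before r f e ↔ toLex (r f, f) < toLex (r e, e) := by
  rw [Prod.Lex.toLex_lt_toLex, before]
  constructor
  · rintro (h | ⟨h, h'⟩)
    · exact Or.inl h
    · rcases h.lt_or_eq with h | h
      · exact Or.inl h
      · exact Or.inr ⟨h, h'⟩
  · rintro (h | ⟨h, h'⟩)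
    · exact Or.inl h
    · exact Or.inr ⟨h.le, h'⟩

theorem before_irrefl (r : Fin G.m → ℝ) (e : Fin G.m) : ¬ G.before r e e := by
  rw [before_iff]; exact lt_irrefl _

theorem before_trans {r : Fin G.m → ℝ} {e f g : Fin G.m} :
    G.before r e f → G.before r f g → G.before r e g := by
  simp only [before_iff]; exact lt_trans

theorem before_or_before (r : Fin G.m → ℝ) {e f : Fin G.m} (h : e ≠ f) :
    G.before r e f ∨ G.before r f e := by
  simp only [before_iff]
  refine lt_or_gt_of_ne fun h' => h ?_
  have := toLex.injective h'
  exact (Prod.mk.inj this).2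

theorem before_eq_of_injective {r : Fin G.m → ℝ} (hr : Function.Injective r) {f e : Fin G.m} :
    G.before r f e ↔ r f < r e := by
  constructor
  · rintro (h | ⟨h, h'⟩)
    · exact h
    · exact lt_of_le_of_ne h (hr.ne h'.ne)
  · exact Or.inl

theorem wellFounded_before (r : Fin G.m → ℝ) : WellFounded (G.before r) :=
  have : IsStrictOrder (Fin G.m) (G.before r) :=
    { irrefl := before_irrefl r, trans := fun _ _ _ => before_trans }
  Finite.wellFounded_of_trans_of_irrefl _

theorem wellFounded_classBlock (c r : Fin G.m → ℝ) : WellFounded (G.classBlock c r) :=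
  Subrelation.wf (fun h => h.2) (wellFounded_before r)

theorem wellFounded_levelBlock (c : Fin G.m → ℝ) : WellFounded (G.levelBlock c) :=
  wellFounded_of_rank (fun e => - c e) fun _ _ h => neg_lt_neg h.2

theorem isGreedy_classSel (c r : Fin G.m → ℝ) :
    IsGreedy (fun _ => True) (G.classBlock c r) (G.classSel c r) :=
  isGreedy_greedy _ (wellFounded_classBlock c r)

theorem isGreedy_classSelDel (c r : Fin G.m → ℝ) (e : Fin G.m) :
    IsGreedy (· ≠ e) (G.classBlock c r) (G.classSelDel c r e) :=
  isGreedy_greedy _ (wellFounded_classBlock c r)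

theorem isGreedy_levelSel (c : Fin G.m → ℝ) (A : Finset (Fin G.m)) :
    IsGreedy (· ∈ A) (G.levelBlock c) (G.levelSel c A) :=
  isGreedy_greedy _ (wellFounded_levelBlock c)

theorem classMatching_of_isGreedy {p : Fin G.m → Prop} {c r : Fin G.m → ℝ} {A : Finset (Fin G.m)}
    (hA : IsGreedy p (G.classBlock c r) A) : G.ClassMatching c A := by
  intro e he f hf hadj hc
  rcases before_or_before r hadj.1 with h | h
  · exact ((hA f).1 hf).2 e ⟨⟨hadj, hc⟩, h⟩ he
  · exact ((hA e).1 he).2 f ⟨⟨hadj.symm, hc.symm⟩, h⟩ hf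

theorem levelSel_subset (c : Fin G.m → ℝ) (A : Finset (Fin G.m)) : G.levelSel c A ⊆ A :=
  fun e he => ((isGreedy_levelSel c A e).1 he).1

theorem ClassMatching.mono {c : Fin G.m → ℝ} {A B : Finset (Fin G.m)} (hA : G.ClassMatching c A)
    (h : B ⊆ A) : G.ClassMatching c B := fun e he f hf => hA e (h he) f (h hf)

theorem ClassMatching.not_adj_levelSel {c : Fin G.m → ℝ} {A : Finset (Fin G.m)}
    (hA : G.ClassMatching c A) {e f : Fin G.m} (he : e ∈ G.levelSel c A)
    (hf : f ∈ G.levelSel c A) : ¬ G.Adj e f := by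
  intro h
  have hB := isGreedy_levelSel c A
  rcases lt_or_gt_of_ne (hA e (levelSel_subset c A he) f (levelSel_subset c A hf) h) with h' | h'
  · exact ((hB e).1 he).2 f ⟨h.symm, h'⟩ hf
  · exact ((hB f).1 hf).2 e ⟨h, h'⟩ he

theorem isMatching_select (c r : Fin G.m → ℝ) : G.IsMatching (G.select c r) := by
  intro e he f hf hne
  by_contra h
  exact (classMatching_of_isGreedy (isGreedy_classSel c r)).not_adj_levelSel he hf ⟨hne, h⟩

/-- The approximation guarantee with respect to the rounded weights. -/
theorem sum_matching_le_select {c r : Fin G.m → ℝ} (hc : Separated c) (h0 : ∀ e, 0 ≤ c e)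
    {O : Finset (Fin G.m)} (hO : G.IsMatching O) :
    ∑ e ∈ O, c e ≤ 10 / 3 * ∑ e ∈ G.select c r, c e := by
  classical
  have hA := isGreedy_classSel c r
  set A := G.classSel c r with hAdef
  have hB := isGreedy_levelSel c A
  have hAm := classMatching_of_isGreedy hA
  -- Discarded edges are charged to larger adjacent selected ones: 1 + 2/3.
  have h1 : ∑ e ∈ A, c e ≤ 5 / 3 * ∑ e ∈ G.levelSel c A, c e := by
    have hsplit := Finset.sum_sdiff (f := c) (levelSel_subset c A)
    have := ClassMatching.sum_le_of_adj (G := G) hc h0 (X := A \ G.levelSel c A)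
      (Y := G.levelSel c A) (hAm.mono Finset.sdiff_subset) (by
        intro f hf
        rw [Finset.mem_sdiff] at hf
        have h := mt (hB f).2 hf.2
        push Not at h
        obtain ⟨g, hg, hgB⟩ := h hf.1
        exact ⟨g, hgB, hg⟩)
    linarith
  -- Each `o ∈ O` is charged to an edge `g o ∈ A` of equal value with which it shares the vertex `v
  -- o`. As `O` is a matching, `v` is injective on a fibre of `g` and maps it into the two endpoints
  -- of one edge.
  have h2 : ∑ e ∈ O, c e ≤ 2 * ∑ e ∈ A, c e := by
    have hex : ∀ o ∈ O, ∃ g ∈ A, c g = c o ∧ ∃ v ∈ G.ends g, v ∈ G.ends o := by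
      intro o _
      by_cases ho : o ∈ A
      · exact ⟨o, ho, rfl, G.src o, by simp [ends], by simp [ends]⟩
      · have h := mt (hA o).2 ho
        push Not at h
        obtain ⟨g, hg, hgA⟩ := h trivial
        obtain ⟨v, hv, hv'⟩ := hg.1.1.exists_mem_ends
        exact ⟨g, hgA, hg.1.2, v, hv', hv⟩
    rcases O.eq_empty_or_nonempty with rfl | ⟨o₀, _⟩
    · simpa using Finset.sum_nonneg fun e _ => h0 e
    have : Nonempty (Fin G.n) := ⟨G.src o₀⟩
    choose! g hgA hgc v hvg hvo using hex
    rw [← Finset.sum_fiberwise_of_maps_to hgA, Finset.mul_sum]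
    refine Finset.sum_le_sum fun y _ => ?_
    have hcard : (O.filter fun o => g o = y).card ≤ 2 := by
      rw [← card_ends y]
      refine Finset.card_le_card_of_injOn v ?_ ?_
      · intro o ho
        simp only [Finset.coe_filter, Set.mem_ofPred_eq] at ho
        have := hvg o ho.1
        rwa [ho.2] at this
      · intro o ho o' ho' hv
        simp only [Finset.coe_filter, Set.mem_ofPred_eq] at ho ho'
        by_contra hne
        exact Finset.disjoint_left.1 (hO o ho.1 o' ho'.1 hne) (hvo o ho.1) (hv ▸ hvo o' ho'.1)
    calc ∑ o ∈ O.filter (fun o => g o = y), c o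
        = ∑ o ∈ O.filter (fun o => g o = y), c y := by
          refine Finset.sum_congr rfl fun o ho => ?_
          simp only [Finset.mem_filter] at ho
          rw [← hgc o ho.1, ho.2]
      _ = (O.filter fun o => g o = y).card * c y := by rw [Finset.sum_const, nsmul_eq_mul]
      _ ≤ 2 * c y := mul_le_mul_of_nonneg_right (by exact_mod_cast hcard) (h0 y)
  rw [select]
  linarith

/-! ### Stability of the two selections -/

theorem sum_symmDiff_eq {ι : Type} [DecidableEq ι] (c : ι → ℝ) (X Y : Finset ι) :
    ∑ f ∈ symmDiff X Y, c f = ∑ f ∈ X \ Y, c f + ∑ f ∈ Y \ X, c f := by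
  rw [symmDiff_def, Finset.sup_eq_union, Finset.sum_union]
  exact disjoint_sdiff_sdiff

/-- A change of `A` changes the greedy matching in `A` by a set of at most three times the value. -/
theorem sum_symmDiff_levelSel_le {c : Fin G.m → ℝ} (hc : Separated c) (h0 : ∀ e, 0 ≤ c e)
    {A A' : Finset (Fin G.m)} (hA : G.ClassMatching c A) (hA' : G.ClassMatching c A') :
    ∑ f ∈ symmDiff (G.levelSel c A) (G.levelSel c A'), c f ≤ 3 * ∑ f ∈ symmDiff A A', c f := by
  -- A lost edge either has left `A`, or is blocked by a larger adjacent edge of the other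
  -- selection, which is itself new because the first selection is independent. Adding both
  -- directions gives S ≤ D + (2/3) S, that is, S ≤ 3 D.
  have key : ∀ {A A' : Finset (Fin G.m)}, G.ClassMatching c A →
      ∑ f ∈ G.levelSel c A \ G.levelSel c A', c f ≤
        ∑ f ∈ A \ A', c f + 2 / 3 * ∑ f ∈ G.levelSel c A' \ G.levelSel c A, c f := by
    intro A A' hA
    have h1 := Finset.sum_filter_add_sum_filter_not (G.levelSel c A \ G.levelSel c A') (· ∈ A') c
    have h2 : ∑ f ∈ (G.levelSel c A \ G.levelSel c A').filter (· ∉ A'), c f ≤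
        ∑ f ∈ A \ A', c f := by
      refine Finset.sum_le_sum_of_subset_of_nonneg (fun f hf => ?_) fun _ _ _ => h0 _
      simp only [Finset.mem_filter, Finset.mem_sdiff] at hf
      exact Finset.mem_sdiff.2 ⟨levelSel_subset c A hf.1.1, hf.2⟩
    have h3 := ClassMatching.sum_le_of_adj (G := G) hc h0
      (X := (G.levelSel c A \ G.levelSel c A').filter (· ∈ A'))
      (Y := G.levelSel c A' \ G.levelSel c A)
      (hA.mono fun f hf => levelSel_subset c A
        (Finset.mem_sdiff.1 (Finset.mem_filter.1 hf).1).1) (by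
        intro f hf
        simp only [Finset.mem_filter, Finset.mem_sdiff] at hf
        have h := mt (isGreedy_levelSel c A' f).2 hf.1.2
        push Not at h
        obtain ⟨g, hg, hgB⟩ := h hf.2
        exact ⟨g, Finset.mem_sdiff.2 ⟨hgB, fun h' => hA.not_adj_levelSel h' hf.1.1 hg.1⟩, hg⟩)
    linarith
  have k1 := key (A' := A') hA
  have k2 := key (A' := A) hA'
  rw [sum_symmDiff_eq, sum_symmDiff_eq]
  linarith

/-- Deleting `e` changes only the class of `e`. -/
theorem eq_of_mem_symmDiff_classSel {c r : Fin G.m → ℝ} {e f : Fin G.m}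
    (hf : f ∈ symmDiff (G.classSel c r) (G.classSelDel c r e)) : c f = c e := by
  by_contra hne
  have key : ∀ x, c x ≠ c e → (x ∈ G.classSel c r ↔ x ∈ G.classSelDel c r e) := by
    intro x
    induction x using (wellFounded_classBlock c r).induction with
    | _ x ih =>
      intro hx
      have hxe : x ≠ e := by rintro rfl; exact hx rfl
      rw [isGreedy_classSel c r x, isGreedy_classSelDel c r e x]
      simp only [true_and, hxe, ne_eq, not_false_eq_true]
      exact forall₂_congr fun y hy => not_congr (ih y hy (by rwa [hy.1.2]))
  rw [Finset.mem_symmDiff, key f hne] at hf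
  tauto

theorem sum_symmDiff_classSel {c r : Fin G.m → ℝ} (e : Fin G.m) :
    ∑ f ∈ symmDiff (G.classSel c r) (G.classSelDel c r e), c f =
      (symmDiff (G.classSel c r) (G.classSelDel c r e)).card * c e := by
  rw [Finset.sum_congr rfl fun f hf => eq_of_mem_symmDiff_classSel hf, Finset.sum_const,
    nsmul_eq_mul]

theorem not_mem_classSelDel (c r : Fin G.m → ℝ) (e : Fin G.m) : e ∉ G.classSelDel c r e :=
  fun h => ((isGreedy_classSelDel c r e e).1 h).1 rfl

/-- After its deletion, the value of `e` is invisible. Two weight vectors that differ only at `e`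
thus share an intermediate selection. -/
theorem classSelDel_congr {c c' r : Fin G.m → ℝ} {e : Fin G.m} (h : ∀ f, f ≠ e → c f = c' f) :
    G.classSelDel c r e = G.classSelDel c' r e := by
  refine IsGreedy.unique (p := (· ≠ e)) (wellFounded_classBlock c' r) (fun x => ?_)
    (isGreedy_classSelDel c' r e)
  rw [isGreedy_classSelDel c r e x]
  refine and_congr_right fun hx => forall_congr' fun y => ?_
  by_cases hy : y = e
  · subst hy
    simp [not_mem_classSelDel]
  · simp only [classBlock, h x hx, h y hy]

theorem levelSel_congr {c c' : Fin G.m → ℝ} {A : Finset (Fin G.m)} (h : ∀ f ∈ A, c f = c' f) :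
    G.levelSel c A = G.levelSel c' A := by
  refine IsGreedy.unique (p := (· ∈ A)) (wellFounded_levelBlock c') (fun x => ?_)
    (isGreedy_levelSel c' A)
  rw [isGreedy_levelSel c A x]
  refine and_congr_right fun hx => forall_congr' fun y => ?_
  by_cases hy : y ∈ A
  · simp only [levelBlock, h x hx, h y hy]
  · exact ⟨fun _ _ h' => hy (levelSel_subset c A h'), fun _ _ h' => hy (levelSel_subset c A h')⟩

/-- The number of changes inside the classes caused by the deletion of `e`, summed over all
permutations of the ranks. -/
theorem sum_card_symmDiff_classSel_le (c : Fin G.m → ℝ) {r : Fin G.m → ℝ}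
    (hr : Function.Injective r) (e : Fin G.m) :
    ∑ π : Equiv.Perm (Fin G.m),
      (symmDiff (G.classSel c (r ∘ π)) (G.classSelDel c (r ∘ π) e)).card ≤
        Fintype.card (Equiv.Perm (Fin G.m)) := by
  -- For injective ranks the tie-break by index never acts, so the average influence bound applies
  -- to the conflict relation "adjacent and in the same class".
  have h : ∀ π : Equiv.Perm (Fin G.m), G.classBlock c (r ∘ π) =
      rankBlock (fun f e => G.Adj f e ∧ c f = c e) (r ∘ π) := by
    intro π
    funext f e
    rw [classBlock, rankBlock, before_eq_of_injective (hr.comp π.injective)]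
  simp only [classSel, classSelDel, h]
  exact sum_card_symmDiff_greedy_delete_le (fun _ _ h => ⟨h.1.symm, h.2.symm⟩)
    (fun _ h => h.1.1 rfl) hr e

/-! ### The distance of outputs -/

theorem dw_triangle (F F' F'' : Finset (Fin G.m)) (w w' w'' : G.Weights) :
    G.dw F w F'' w'' ≤ G.dw F w F' w' + G.dw F' w' F'' w'' := by
  rw [dw, dw, dw, ← Finset.sum_add_distrib]
  exact Finset.sum_le_sum fun _ _ => abs_sub_le _ _ _

theorem dw_nonneg (F F' : Finset (Fin G.m)) (w w' : G.Weights) : 0 ≤ G.dw F w F' w' :=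
  Finset.sum_nonneg fun _ _ => abs_nonneg _

theorem dw_comm (F F' : Finset (Fin G.m)) (w w' : G.Weights) :
    G.dw F w F' w' = G.dw F' w' F w :=
  Finset.sum_congr rfl fun _ _ => abs_sub_comm _ _

theorem dw_same_weight (F F' : Finset (Fin G.m)) (w : G.Weights) :
    G.dw F w F' w = ∑ f ∈ symmDiff F F', (w f : ℝ) := by
  rw [dw, ← Finset.sum_filter_add_sum_filter_not Finset.univ (· ∈ symmDiff F F')]
  have h2 : ∑ x with x ∉ symmDiff F F', |G.weightedVec F w x - G.weightedVec F' w x| = 0 := by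
    refine Finset.sum_eq_zero fun x hx => ?_
    simp only [Finset.mem_filter, Finset.mem_univ, true_and, Finset.mem_symmDiff, not_or,
      not_and, not_not] at hx
    have : x ∈ F ↔ x ∈ F' := ⟨hx.1, hx.2⟩
    simp [weightedVec, this]
  rw [h2, add_zero]
  refine Finset.sum_congr (by ext; simp) fun x hx => ?_
  rcases Finset.mem_symmDiff.1 hx with h | h <;> simp [weightedVec, h.1, h.2]

theorem dw_same_set_le (F : Finset (Fin G.m)) (w w' : G.Weights) :
    G.dw F w F w' ≤ ∑ e ∈ F, |(w e : ℝ) - w' e| := by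
  rw [dw, ← Finset.sum_filter_add_sum_filter_not Finset.univ (· ∈ F)]
  have h2 : ∑ x with x ∉ F, |G.weightedVec F w x - G.weightedVec F w' x| = 0 := by
    refine Finset.sum_eq_zero fun x hx => ?_
    simp only [Finset.mem_filter, Finset.mem_univ, true_and] at hx
    simp [weightedVec, hx]
  rw [h2, add_zero]
  refine le_of_eq (Finset.sum_congr (by ext; simp) fun x hx => ?_)
  simp [weightedVec, hx]

/-- The cost of deleting `e` before the selection. -/
theorem dw_select_delete_le {c r : Fin G.m → ℝ} (hc : Separated c) (h0 : ∀ e, 0 ≤ c e)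
    {w : G.Weights} (hw : ∀ e, (w e : ℝ) ≤ 4 * c e) (e : Fin G.m) :
    G.dw (G.select c r) w (G.levelSel c (G.classSelDel c r e)) w ≤
      12 * c e * (symmDiff (G.classSel c r) (G.classSelDel c r e)).card := by
  rw [dw_same_weight]
  -- The constant 12 is 3 from the level selection times 4 from `w ≤ 4 * c`.
  have h1 := sum_symmDiff_levelSel_le hc h0
    (classMatching_of_isGreedy (isGreedy_classSel c r))
    (classMatching_of_isGreedy (isGreedy_classSelDel c r e))
  rw [sum_symmDiff_classSel] at h1
  calc _ ≤ ∑ f ∈ symmDiff (G.select c r) (G.levelSel c (G.classSelDel c r e)), 4 * c f :=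
        Finset.sum_le_sum fun f _ => hw f
    _ = 4 * ∑ f ∈ symmDiff (G.levelSel c (G.classSel c r))
          (G.levelSel c (G.classSelDel c r e)), c f := by rw [Finset.mul_sum, select]
    _ ≤ _ := by linarith

/-- The effect of changing the weight of one edge, summed over all permutations of the ranks. -/
theorem sum_dw_select_le {c c' : Fin G.m → ℝ} (hc : Separated c) (h0 : ∀ e, 0 ≤ c e)
    (hc' : Separated c') (h0' : ∀ e, 0 ≤ c' e) {w w' : G.Weights}
    (hw : ∀ e, (w e : ℝ) ≤ 4 * c e) (hw' : ∀ e, (w' e : ℝ) ≤ 4 * c' e) (e : Fin G.m)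
    (hcc : ∀ f, f ≠ e → c f = c' f) (hww : ∀ f, f ≠ e → w f = w' f)
    (hsep : c e < c' e → 4 * c e ≤ c' e) (hsep' : c' e < c e → 4 * c' e ≤ c e)
    {r : Fin G.m → ℝ} (hr : Function.Injective r) :
    ∑ π : Equiv.Perm (Fin G.m), G.dw (G.select c (r ∘ π)) w (G.select c' (r ∘ π)) w' ≤
      Fintype.card (Equiv.Perm (Fin G.m)) *
        (|(w e : ℝ) - w' e| + 20 * |c e - c' e|) := by
  by_cases heq : c e = c' e
  · have hccf : c = c' := by
      funext f
      by_cases hf : f = e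
      · rw [hf, heq]
      · exact hcc f hf
    subst hccf
    rw [← nsmul_eq_mul, ← Finset.card_univ]
    refine Finset.sum_le_card_nsmul _ _ _ fun π _ => ?_
    refine (dw_same_set_le _ _ _).trans ?_
    refine (Finset.sum_le_univ_sum_of_nonneg fun _ => abs_nonneg _).trans ?_
    rw [Finset.sum_eq_single e]
    · simp
    · intro f _ hf
      rw [hww f hf, sub_self, abs_zero]
    · simp
  · have hpt : ∀ π : Equiv.Perm (Fin G.m),
        G.dw (G.select c (r ∘ π)) w (G.select c' (r ∘ π)) w' ≤
          12 * c e * (symmDiff (G.classSel c (r ∘ π)) (G.classSelDel c (r ∘ π) e)).card +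
          12 * c' e * (symmDiff (G.classSel c' (r ∘ π)) (G.classSelDel c' (r ∘ π) e)).card := by
      intro π
      have hD : G.levelSel c' (G.classSelDel c' (r ∘ π) e) =
          G.levelSel c (G.classSelDel c (r ∘ π) e) := by
        rw [← classSelDel_congr hcc]
        refine levelSel_congr fun f hf => (hcc f ?_).symm
        rintro rfl
        exact not_mem_classSelDel _ _ _ hf
      have h1 := dw_select_delete_le (r := r ∘ π) hc h0 hw e
      have h2 := dw_select_delete_le (r := r ∘ π) hc' h0' hw' e
      rw [hD] at h2
      set D := G.levelSel c (G.classSelDel c (r ∘ π) e)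
      have h3 : G.dw D w D w' ≤ 0 := by
        refine (dw_same_set_le _ _ _).trans (le_of_eq (Finset.sum_eq_zero fun f hf => ?_))
        have : f ≠ e := by
          rintro rfl
          exact not_mem_classSelDel _ _ _ (levelSel_subset _ _ hf)
        rw [hww f this, sub_self, abs_zero]
      have t1 := dw_triangle (G.select c (r ∘ π)) D (G.select c' (r ∘ π)) w w w'
      have t2 := dw_triangle D D (G.select c' (r ∘ π)) w w' w'
      rw [dw_comm D (G.select c' (r ∘ π)) w' w'] at t2
      linarith
    have s1 : (∑ π : Equiv.Perm (Fin G.m),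
        ((symmDiff (G.classSel c (r ∘ π)) (G.classSelDel c (r ∘ π) e)).card : ℝ)) ≤
        Fintype.card (Equiv.Perm (Fin G.m)) := by
      exact_mod_cast sum_card_symmDiff_classSel_le c hr e
    have s2 : (∑ π : Equiv.Perm (Fin G.m),
        ((symmDiff (G.classSel c' (r ∘ π)) (G.classSelDel c' (r ∘ π) e)).card : ℝ)) ≤
        Fintype.card (Equiv.Perm (Fin G.m)) := by
      exact_mod_cast sum_card_symmDiff_classSel_le c' hr e
    -- If the larger value is M, the smaller is at most M/4. The left side is at most 15 M and the
    -- difference at least 3M/4, whence 20.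
    have hnum : 12 * c e + 12 * c' e ≤ |(w e : ℝ) - w' e| + 20 * |c e - c' e| := by
      have := abs_nonneg ((w e : ℝ) - w' e)
      rcases lt_or_gt_of_ne heq with h | h
      · have := hsep h
        rw [abs_of_neg (sub_neg.2 h)]; linarith
      · have := hsep' h
        rw [abs_of_pos (sub_pos.2 h)]; linarith
    calc _ ≤ ∑ π : Equiv.Perm (Fin G.m), (12 * c e *
            ((symmDiff (G.classSel c (r ∘ π)) (G.classSelDel c (r ∘ π) e)).card : ℝ) +
          12 * c' e * (symmDiff (G.classSel c' (r ∘ π)) (G.classSelDel c' (r ∘ π) e)).card) :=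
          Finset.sum_le_sum fun π _ => hpt π
      _ ≤ 12 * c e * Fintype.card (Equiv.Perm (Fin G.m)) +
          12 * c' e * Fintype.card (Equiv.Perm (Fin G.m)) := by
          rw [Finset.sum_add_distrib, ← Finset.mul_sum, ← Finset.mul_sum]
          have := h0 e
          have := h0' e
          gcongr
      _ = Fintype.card (Equiv.Perm (Fin G.m)) * (12 * c e + 12 * c' e) := by ring
      _ ≤ _ := by gcongr

end EdgeList

/-! ### Rounding to a randomly shifted geometric scale -/

/-- The largest `x * 4 ^ i` that is at most `w`, for `1 ≤ x ≤ 4` and `0 < w`. -/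
def rd (x w : ℝ) : ℝ :=
  if w = 0 then 0
  else if x * 4 ^ Int.log 4 w ≤ w then x * 4 ^ Int.log 4 w else x * 4 ^ (Int.log 4 w - 1)

theorem rd_zero (x : ℝ) : rd x 0 = 0 := by simp [rd]

theorem log_bounds {w : ℝ} (hw : 0 < w) :
    (4 : ℝ) ^ Int.log 4 w ≤ w ∧ w < 4 * (4 : ℝ) ^ Int.log 4 w := by
  have h1 := Int.zpow_log_le_self (b := 4) (by norm_num) hw
  have h2 := Int.lt_zpow_succ_log_self (b := 4) (by norm_num) w
  rw [Nat.cast_ofNat] at h1 h2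
  refine ⟨h1, ?_⟩
  rwa [zpow_add_one₀ (by norm_num), mul_comm] at h2

theorem rd_of_pos {x w : ℝ} (hx1 : 1 ≤ x) (hx4 : x ≤ 4) (hw : 0 < w) :
    (∃ i : ℤ, rd x w = x * 4 ^ i) ∧ rd x w ≤ w ∧ w < 4 * rd x w := by
  obtain ⟨h1, h2⟩ := log_bounds hw
  have hK : (0 : ℝ) < 4 ^ Int.log 4 w := by positivity
  rw [rd, if_neg hw.ne']
  split_ifs with h
  · exact ⟨⟨_, rfl⟩, h, by nlinarith⟩
  · refine ⟨⟨_, rfl⟩, ?_, ?_⟩ <;> rw [zpow_sub_one₀ (by norm_num)]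
    · nlinarith
    · rw [not_le] at h; linarith

/-- The grid has exactly one point in (w/4, w]; this characterization identifies the value found by
the loops of the program. -/
theorem eq_rd {x w v : ℝ} (hx1 : 1 ≤ x) (hx4 : x ≤ 4) (hw : 0 < w) {i : ℤ} (hv : v = x * 4 ^ i)
    (h1 : v ≤ w) (h2 : w < 4 * v) : v = rd x w := by
  obtain ⟨⟨j, hj⟩, h3, h4⟩ := rd_of_pos hx1 hx4 hw
  have key : ∀ a b : ℤ, x * 4 ^ a ≤ w → w < 4 * (x * 4 ^ b) → a ≤ b := by
    intro a b ha hb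
    have : x * (4 : ℝ) ^ a < x * 4 ^ (b + 1) := by
      rw [zpow_add_one₀ (by norm_num)]; linarith
    have := lt_of_mul_lt_mul_left this (by linarith)
    have := (zpow_lt_zpow_iff_right₀ (by norm_num : (1 : ℝ) < 4)).1 this
    omega
  rw [hj] at h3 h4
  rw [hv] at h1 h2
  rw [hv, hj, le_antisymm (key i j h1 h4) (key j i h3 h2)]

theorem rd_le {x w : ℝ} (hx1 : 1 ≤ x) (hx4 : x ≤ 4) (hw : 0 ≤ w) : rd x w ≤ w := by
  rcases hw.eq_or_lt with rfl | h
  · rw [rd_zero]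
  · exact (rd_of_pos hx1 hx4 h).2.1

theorem le_four_mul_rd {x w : ℝ} (hx1 : 1 ≤ x) (hx4 : x ≤ 4) (hw : 0 ≤ w) : w ≤ 4 * rd x w := by
  rcases hw.eq_or_lt with rfl | h
  · rw [rd_zero, mul_zero]
  · exact (rd_of_pos hx1 hx4 h).2.2.le

theorem rd_nonneg {x w : ℝ} (hx1 : 1 ≤ x) (hx4 : x ≤ 4) (hw : 0 ≤ w) : 0 ≤ rd x w := by
  have := le_four_mul_rd hx1 hx4 hw
  linarith

theorem four_mul_rd_le {x a b : ℝ} (hx1 : 1 ≤ x) (hx4 : x ≤ 4) (ha : 0 ≤ a) (hb : 0 ≤ b)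
    (h : rd x a < rd x b) :
    4 * rd x a ≤ rd x b := by
  rcases ha.eq_or_lt with rfl | ha
  · rw [rd_zero, mul_zero]
    exact rd_nonneg hx1 hx4 hb
  rcases hb.eq_or_lt with rfl | hb
  · rw [rd_zero] at h
    exact absurd (rd_nonneg hx1 hx4 ha.le) (not_le.2 h)
  obtain ⟨⟨i, hi⟩, -⟩ := rd_of_pos hx1 hx4 ha
  obtain ⟨⟨j, hj⟩, -⟩ := rd_of_pos hx1 hx4 hb
  rw [hi, hj] at h ⊢
  have := lt_of_mul_lt_mul_left h (by linarith)
  have := (zpow_lt_zpow_iff_right₀ (by norm_num : (1 : ℝ) < 4)).1 this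
  have : (4 : ℝ) ^ (i + 1) ≤ 4 ^ j := zpow_le_zpow_right₀ (by norm_num) (by omega)
  rw [zpow_add_one₀ (by norm_num)] at this
  nlinarith

/-- A reversal would give b ≤ 4 · rd x b ≤ rd x a ≤ a by separation, hence a = b. -/
theorem rd_mono {x a b : ℝ} (hx1 : 1 ≤ x) (hx4 : x ≤ 4) (ha : 0 ≤ a) (hab : a ≤ b) : rd x a ≤ rd x b := by
  by_contra h
  have h1 := four_mul_rd_le hx1 hx4 (ha.trans hab) ha (not_le.1 h)
  have h2 := le_four_mul_rd hx1 hx4 (ha.trans hab)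
  have h3 := rd_le hx1 hx4 ha
  have h4 : a = b := by linarith
  rw [h4] at h
  exact h le_rfl

theorem measurable_rd (w : ℝ) : Measurable fun x => rd x w := by
  unfold rd
  split_ifs
  · exact measurable_const
  · refine Measurable.ite ?_ (by fun_prop) (by fun_prop)
    exact measurableSet_le (by fun_prop) measurable_const

/-- The expectation of the rounded value of `w` for `x` uniform in `[1, 4]`. -/
def rdMean (w : ℝ) : ℝ :=
  if w = 0 then 0 else (w ^ 2 / 4 ^ Int.log 4 w + 4 * 4 ^ Int.log 4 w) / 8

theorem integral_rd_of_pos {w : ℝ} (hw : 0 < w) : ∫ u in (0 : ℝ)..1, rd (1 + 3 * u) w = rdMean w := by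
  obtain ⟨h1, h2⟩ := log_bounds hw
  have hK : (0 : ℝ) < 4 ^ Int.log 4 w := by positivity
  have hrd : ∀ u, rd (1 + 3 * u) w = if (1 + 3 * u) * 4 ^ Int.log 4 w ≤ w
      then (1 + 3 * u) * 4 ^ Int.log 4 w else (1 + 3 * u) * (4 ^ Int.log 4 w / 4) := by
    intro u
    rw [rd, if_neg hw.ne', zpow_sub_one₀ (by norm_num)]
    rfl
  simp only [hrd, rdMean, if_neg hw.ne']
  set K : ℝ := 4 ^ Int.log 4 w
  -- The value of `u` at which the shift `1 + 3 * u` passes `w / K` and the rounding drops by one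
  -- power of 4.
  set t : ℝ := (w / K - 1) / 3 with ht
  have htK : (1 + 3 * t) * K = w := by rw [ht]; field_simp; ring
  have ht0 : 0 ≤ t := by nlinarith
  have ht1 : t ≤ 1 := by nlinarith
  have e1 : Set.EqOn (fun u => (1 + 3 * u) * K) (fun u => if (1 + 3 * u) * K ≤ w
      then (1 + 3 * u) * K else (1 + 3 * u) * (K / 4)) (Set.Ioc 0 t) := by
    intro u hu
    have : (1 + 3 * u) * K ≤ w := by rw [← htK]; nlinarith [hu.2]
    simp only [if_pos this]
  have e2 : Set.EqOn (fun u => (1 + 3 * u) * (K / 4)) (fun u => if (1 + 3 * u) * K ≤ w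
      then (1 + 3 * u) * K else (1 + 3 * u) * (K / 4)) (Set.Ioc t 1) := by
    intro u hu
    have : ¬ (1 + 3 * u) * K ≤ w := by rw [← htK]; nlinarith [hu.1]
    simp only [if_neg this]
  have i1 : IntervalIntegrable (fun u => (1 + 3 * u) * K) volume 0 t :=
    (by fun_prop : Continuous fun u : ℝ => (1 + 3 * u) * K).intervalIntegrable _ _
  have i2 : IntervalIntegrable (fun u => (1 + 3 * u) * (K / 4)) volume t 1 :=
    (by fun_prop : Continuous fun u : ℝ => (1 + 3 * u) * (K / 4)).intervalIntegrable _ _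
  rw [← Set.uIoc_of_le ht0] at e1
  rw [← Set.uIoc_of_le ht1] at e2
  rw [← intervalIntegral.integral_add_adjacent_intervals (i1.congr e1) (i2.congr e2)]
  rw [← intervalIntegral.integral_congr_ae (ae_of_all _ e1),
    ← intervalIntegral.integral_congr_ae (ae_of_all _ e2)]
  have hlin : ∀ a b c : ℝ, ∫ u in a..b, (1 + 3 * u) * c =
      ((b - a) + 3 * ((b ^ 2 - a ^ 2) / 2)) * c := by
    intro a b c
    rw [intervalIntegral.integral_mul_const, intervalIntegral.integral_add (by simp)
      (Continuous.intervalIntegrable (by fun_prop) _ _), intervalIntegral.integral_const_mul,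
      integral_id]
    simp
  rw [hlin, hlin, ← htK]
  field_simp
  ring

theorem integral_rd {w : ℝ} (hw : 0 ≤ w) : ∫ u in (0 : ℝ)..1, rd (1 + 3 * u) w = rdMean w := by
  rcases hw.eq_or_lt with rfl | h
  · simp [rd_zero, rdMean]
  · exact integral_rd_of_pos h

/-- The inequality of arithmetic and geometric means, with equality at `w = 2 * K`. -/
theorem half_le_rdMean {w : ℝ} (hw : 0 ≤ w) : w / 2 ≤ rdMean w := by
  rcases hw.eq_or_lt with rfl | h
  · simp [rdMean]
  rw [rdMean, if_neg h.ne']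
  have hK : (0 : ℝ) < 4 ^ Int.log 4 w := by positivity
  set K : ℝ := 4 ^ Int.log 4 w
  have : (w ^ 2 / K + 4 * K) / 8 - w / 2 = (w - 2 * K) ^ 2 / (8 * K) := by field_simp; ring
  have : 0 ≤ (w - 2 * K) ^ 2 / (8 * K) := by positivity
  linarith

theorem rdMean_le {w : ℝ} (hw : 0 ≤ w) : rdMean w ≤ 5 / 8 * w := by
  rcases hw.eq_or_lt with rfl | h
  · simp [rdMean]
  rw [rdMean, if_neg h.ne']
  obtain ⟨h1, h2⟩ := log_bounds h
  have hK : (0 : ℝ) < 4 ^ Int.log 4 w := by positivity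
  set K : ℝ := 4 ^ Int.log 4 w
  have : 5 / 8 * w - (w ^ 2 / K + 4 * K) / 8 = (w - K) * (4 * K - w) / (8 * K) := by
    field_simp; ring
  have : 0 ≤ (w - K) * (4 * K - w) / (8 * K) :=
    div_nonneg (mul_nonneg (by linarith) (by linarith)) (by positivity)
  linarith

/-- On [K, 4K] the mean is quadratic with slope w/(4K) ≤ 1, and consecutive pieces agree where they
meet, with value 5/8 of the argument. -/
theorem rdMean_sub_le {a b : ℝ} (ha : 0 ≤ a) (hab : a ≤ b) : rdMean b - rdMean a ≤ b - a := by
  rcases ha.eq_or_lt with rfl | ha0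
  · have := rdMean_le hab
    have h0 : rdMean 0 = 0 := by simp [rdMean]
    linarith
  have hb0 := ha0.trans_le hab
  obtain ⟨a1, a2⟩ := log_bounds ha0
  obtain ⟨b1, b2⟩ := log_bounds hb0
  have hA : rdMean a = (a ^ 2 / 4 ^ Int.log 4 a + 4 * 4 ^ Int.log 4 a) / 8 := by
    rw [rdMean, if_neg ha0.ne']
  have hB : rdMean b = (b ^ 2 / 4 ^ Int.log 4 b + 4 * 4 ^ Int.log 4 b) / 8 := by
    rw [rdMean, if_neg hb0.ne']
  have hK : (0 : ℝ) < 4 ^ Int.log 4 a := by positivity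
  have hL : (0 : ℝ) < 4 ^ Int.log 4 b := by positivity
  have hmono : Int.log 4 a ≤ Int.log 4 b := Int.log_mono_right ha0 hab
  have hstep : (4 : ℝ) ^ (Int.log 4 a + 1) = 4 * 4 ^ Int.log 4 a := by
    rw [zpow_add_one₀ (by norm_num), mul_comm]
  rcases hmono.eq_or_lt with h | h
  · rw [hA, hB, ← h]
    rw [← h] at b2
    set K : ℝ := 4 ^ Int.log 4 a
    have : b - a - ((b ^ 2 / K + 4 * K) / 8 - (a ^ 2 / K + 4 * K) / 8) =
        (b - a) * (8 * K - (a + b)) / (8 * K) := by field_simp; ring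
    have : 0 ≤ (b - a) * (8 * K - (a + b)) / (8 * K) :=
      div_nonneg (mul_nonneg (by linarith) (by linarith)) (by positivity)
    linarith
  · have hKL : 4 * (4 : ℝ) ^ Int.log 4 a ≤ 4 ^ Int.log 4 b := by
      rw [← hstep]
      exact zpow_le_zpow_right₀ (by norm_num) (by omega)
    have hB' : rdMean b - 5 / 8 * 4 ^ Int.log 4 b ≤ b - 4 ^ Int.log 4 b := by
      rw [hB]
      set L : ℝ := 4 ^ Int.log 4 b
      have : b - L - ((b ^ 2 / L + 4 * L) / 8 - 5 / 8 * L) =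
          (b - L) * (7 * L - b) / (8 * L) := by field_simp; ring
      have : 0 ≤ (b - L) * (7 * L - b) / (8 * L) :=
        div_nonneg (mul_nonneg (by linarith) (by linarith)) (by positivity)
      linarith
    -- Neighbouring pieces are compared through their common endpoint. If the exponents differ by at
    -- least two, the crude bound `a / 2` for the mean at `a` is enough.
    rcases (by omega : Int.log 4 a + 1 ≤ Int.log 4 b).eq_or_lt with h' | h'
    · have hL' : (4 : ℝ) ^ Int.log 4 b = 4 * 4 ^ Int.log 4 a := by rw [← h', hstep]
      rw [hL'] at hB'
      have hA' : 5 / 8 * (4 * 4 ^ Int.log 4 a) - rdMean a ≤ 4 * 4 ^ Int.log 4 a - a := by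
        rw [hA]
        set K : ℝ := 4 ^ Int.log 4 a
        have : 4 * K - a - (5 / 8 * (4 * K) - (a ^ 2 / K + 4 * K) / 8) =
            (4 * K - a) ^ 2 / (8 * K) := by field_simp; ring
        have : 0 ≤ (4 * K - a) ^ 2 / (8 * K) := by positivity
        linarith
      linarith
    · have hL' : 4 * (4 * (4 : ℝ) ^ Int.log 4 a) ≤ 4 ^ Int.log 4 b := by
        rw [← hstep, mul_comm, ← zpow_add_one₀ (by norm_num)]
        exact zpow_le_zpow_right₀ (by norm_num) (by omega)
      have := half_le_rdMean ha
      linarith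

/-! ### Total correctness with time bounds -/

/-- Started in `s`, the program halts within `T` steps in a state satisfying `Q`. -/
def Runs (P : Prog) (s : State) (T : ℕ) (Q : State → Prop) : Prop :=
  ∃ t s', Exec P s t s' ∧ t ≤ T ∧ Q s'

namespace Runs

variable {P P' : Prog} {s : State} {T T' : ℕ} {Q Q' : State → Prop}

theorem mono (h : Runs P s T Q) (hT : T ≤ T') (hQ : ∀ s', Q s' → Q' s') : Runs P s T' Q' := by
  obtain ⟨t, s', h1, h2, h3⟩ := h
  exact ⟨t, s', h1, h2.trans hT, hQ s' h3⟩

theorem skip (h : Q s) : Runs .skip s 1 Q := ⟨1, s, .skip s, le_rfl, h⟩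

theorem setN {a : ℕ} {i x : NExpr}
    (h : Q { s with nat := store s.nat a (i.eval s) (x.eval s) }) :
    Runs (.setN a i x) s (1 + i.cost + x.cost) Q := ⟨_, _, .setN s a i x, le_rfl, h⟩

theorem setR {a : ℕ} {i : NExpr} {x : RExpr}
    (h : Q { s with real := store s.real a (i.eval s) (x.eval s) }) :
    Runs (.setR a i x) s (1 + i.cost + x.cost) Q := ⟨_, _, .setR s a i x, le_rfl, h⟩

theorem sample {a : ℕ} {i : NExpr}
    (h : Q { s with
      real := store s.real a (i.eval s) ((s.tape 0 : I) : ℝ)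
      tape := fun k => s.tape (k + 1) }) :
    Runs (.sample a i) s (1 + i.cost) Q := ⟨_, _, .sample s a i, le_rfl, h⟩

theorem seq (h : Runs P s T Q) (h' : ∀ s', Q s' → Runs P' s' T' Q') :
    Runs (.seq P P') s (T + T') Q' := by
  obtain ⟨t, s', h1, h2, h3⟩ := h
  obtain ⟨t', s'', h1', h2', h3'⟩ := h' s' h3
  exact ⟨_, _, .seq h1 h1', add_le_add h2 h2', h3'⟩

theorem ite {b : BExpr} (h : b.holds s → Runs P s T Q) (h' : ¬ b.holds s → Runs P' s T' Q) :
    Runs (.ite b P P') s (1 + b.cost + (T + T')) Q := by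
  by_cases hb : b.holds s
  · obtain ⟨t, s', h1, h2, h3⟩ := h hb
    exact ⟨_, _, .ite_true hb h1, by omega, h3⟩
  · obtain ⟨t, s', h1, h2, h3⟩ := h' hb
    exact ⟨_, _, .ite_false hb h1, by omega, h3⟩

/-- A loop whose invariant can hold before at most `J` executions of the body. -/
theorem loop {b : BExpr} (Inv : ℕ → State → Prop) (J : ℕ)
    (hstep : ∀ j s, Inv j s → b.holds s → j < J ∧ Runs P s T (Inv (j + 1))) (h0 : Inv 0 s) :
    Runs (.loop b P) s ((J + 1) * (1 + b.cost + T)) fun s' => ∃ j, Inv j s' ∧ ¬ b.holds s' := by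
  have key : ∀ k j s, Inv j s → J ≤ j + k →
      Runs (.loop b P) s ((k + 1) * (1 + b.cost + T)) fun s' => ∃ j, Inv j s' ∧ ¬ b.holds s' := by
    intro k
    induction k with
    | zero =>
      intro j s hj hJ
      have hb : ¬ b.holds s := fun hb => by
        have := (hstep j s hj hb).1
        omega
      exact ⟨_, _, .loop_false hb, by omega, j, hj, hb⟩
    | succ k ih =>
      intro j s hj hJ
      by_cases hb : b.holds s
      · obtain ⟨t, s', h1, h2, h3⟩ := (hstep j s hj hb).2
        obtain ⟨t', s'', h1', h2', h3'⟩ := ih (j + 1) s' h3 (by omega)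
        refine ⟨_, _, .loop_true hb h1 h1', ?_, h3'⟩
        have : (k + 1 + 1) * (1 + b.cost + T) =
          (1 + b.cost + T) + (k + 1) * (1 + b.cost + T) := by ring
        omega
      · exact ⟨_, _, .loop_false hb, by nlinarith [Nat.zero_le (k * (1 + b.cost + T))], j, hj, hb⟩
  exact key J 0 s h0 (by omega)

end Runs

theorem store_apply {β : Type} (mem : ℕ → ℕ → β) (a i : ℕ) (v : β) (a' i' : ℕ) :
    store mem a i v a' i' = if a' = a ∧ i' = i then v else mem a' i' := by
  rw [store]
  by_cases h : a' = a
  · subst h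
    by_cases h' : i' = i
    · subst h'; simp
    · simp [h']
  · simp [h]

/-! ### Derived program constructs -/

/-- `x < y` for integers. -/
def BExpr.ltN (x y : NExpr) : BExpr := .neg (.leN y x)

/-- `x = y` for integers. -/
def BExpr.eqN (x y : NExpr) : BExpr := .conj (.leN x y) (.leN y x)

/-- `x < y` for reals. -/
def BExpr.ltR (x y : RExpr) : BExpr := .neg (.leR y x)

/-- `x = y` for reals. -/
def BExpr.eqR (x y : RExpr) : BExpr := .conj (.leR x y) (.leR y x)

/-- Disjunction. -/
def BExpr.disj (b c : BExpr) : BExpr := .neg (.conj (.neg b) (.neg c))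

section Holds

variable (s : State)

theorem holds_ltN (x y : NExpr) : (BExpr.ltN x y).holds s ↔ x.eval s < y.eval s := not_le

theorem holds_eqN (x y : NExpr) : (BExpr.eqN x y).holds s ↔ x.eval s = y.eval s :=
  le_antisymm_iff.symm

theorem holds_ltR (x y : RExpr) : (BExpr.ltR x y).holds s ↔ x.eval s < y.eval s := not_le

theorem holds_leR (x y : RExpr) : (BExpr.leR x y).holds s ↔ x.eval s ≤ y.eval s := Iff.rfl

theorem holds_eqR (x y : RExpr) : (BExpr.eqR x y).holds s ↔ x.eval s = y.eval s :=
  le_antisymm_iff.symm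

theorem holds_conj (b c : BExpr) : (BExpr.conj b c).holds s ↔ b.holds s ∧ c.holds s := Iff.rfl

theorem holds_disj (b c : BExpr) : (BExpr.disj b c).holds s ↔ b.holds s ∨ c.holds s := by
  simp only [BExpr.disj, BExpr.holds]
  tauto

end Holds

/-- The variable that is stored in cell `0` of the integer array `a`. -/
def NExpr.var (a : ℕ) : NExpr := .cell a (.const 0)

/-- Increase a variable by one. -/
def Prog.incr (a : ℕ) : Prog := .setN a (.const 0) (.add (.var a) (.const 1))

/-- Repeat `P` for all values `0, …, N - 1` of a variable, where `N` is the value of `x`. -/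
def Prog.forLoop (a : ℕ) (x : NExpr) (P : Prog) : Prog :=
  .seq (.setN a (.const 0) (.const 0)) (.loop (.ltN (.var a) x) (.seq P (.incr a)))

/-- A time bound for a `forLoop` in terms of the bounds `N` for the number of rounds and `T` for
a round. -/
def forTime (x : NExpr) (N T : ℕ) : ℕ := 3 + (N + 1) * (1 + (4 + x.cost) + (T + 6))

/-- The invariant may mention the counter: the body has to preserve the counter and to establish the
next invariant for the state after the increment. -/
theorem Runs.forLoop {a : ℕ} {x : NExpr} {P : Prog} {s : State} {T : ℕ} (Inv : ℕ → State → Prop)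
    (N : ℕ) (hx : ∀ i s, Inv i s → s.nat a 0 = i ∧ x.eval s = N)
    (hstep : ∀ i s, i < N → Inv i s →
      Runs P s T fun s' => s'.nat a 0 = i ∧ Inv (i + 1) { s' with nat := store s'.nat a 0 (i + 1) })
    (h0 : Inv 0 { s with nat := store s.nat a 0 0 }) :
    Runs (.forLoop a x P) s (forTime x N T) (Inv N) := by
  refine Runs.seq (T := 3) (Runs.setN (Q := fun s => Inv 0 s) h0) fun s' h0 => ?_
  have hT : 1 + (4 + x.cost) + (T + 6) = 1 + (BExpr.ltN (.var a) x).cost + (T + 6) := by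
    simp only [BExpr.ltN, BExpr.cost, NExpr.var, NExpr.cost]
    ring
  rw [hT]
  refine (Runs.loop (fun i s => Inv i s ∧ i ≤ N) N ?_ ⟨h0, Nat.zero_le _⟩).mono le_rfl ?_
  · rintro i s ⟨hi, _⟩ hb
    rw [holds_ltN, NExpr.var, NExpr.eval, NExpr.eval, (hx i s hi).1, (hx i s hi).2] at hb
    refine ⟨hb, Runs.seq (hstep i s hb hi) fun s' hs' => ?_⟩
    refine Runs.setN ⟨?_, hb⟩
    simpa only [NExpr.eval, NExpr.var, hs'.1] using hs'.2
  · rintro s' ⟨j, ⟨hj, hjN⟩, hb⟩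
    rw [holds_ltN, NExpr.var, NExpr.eval, NExpr.eval, (hx j s' hj).1, (hx j s' hj).2] at hb
    have : j = N := by omega
    exact this ▸ hj

/-! ### The program

Integer arrays: `3` and `4` hold the current versions of the output and of the class matchings, `5`,
`6`, `7` are loop counters, `8` and `9` flags. Real arrays: `1` holds the ranks, `2` the rounded
weights, `3` the shift of the scale. -/

/-- The number of edges. -/
def numEdges : NExpr := .cell 0 (.const 1)

/-- The edges `e` and `f` of the outer and of the inner loop share an endpoint. -/
def overlapTest : BExpr :=
  .disj
    (.disj (.eqN (.cell 1 (.var 7)) (.cell 1 (.var 6))) (.eqN (.cell 1 (.var 7)) (.cell 2 (.var 6))))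
    (.disj (.eqN (.cell 2 (.var 7)) (.cell 1 (.var 6))) (.eqN (.cell 2 (.var 7)) (.cell 2 (.var 6))))

/-- The edge `f` precedes `e`. -/
def beforeTest : BExpr :=
  .disj (.ltR (.cell 1 (.var 7)) (.cell 1 (.var 6)))
    (.conj (.leR (.cell 1 (.var 7)) (.cell 1 (.var 6))) (.ltN (.var 7) (.var 6)))

/-- The edge `f` blocks `e` inside its class. -/
def classTest : BExpr :=
  .conj (.conj (.conj overlapTest (.eqR (.cell 2 (.var 7)) (.cell 2 (.var 6)))) beforeTest)
    (.ltN (.const 0) (.cell 4 (.var 7)))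

/-- The edge `f` blocks `e` from a larger class. -/
def levelTest : BExpr :=
  .conj (.conj overlapTest (.ltR (.cell 2 (.var 6)) (.cell 2 (.var 7))))
    (.ltN (.const 0) (.cell 3 (.var 7)))

/-- Account for the edge `f` in the update of `e`. -/
def scanBody : Prog :=
  .seq (.ite classTest (.setN 8 (.const 0) (.const 0)) .skip)
    (.ite levelTest (.setN 9 (.const 0) (.const 0)) .skip)

/-- Update the status of the edge `e`. -/
def updateEdge : Prog :=
  .seq (.setN 8 (.const 0) (.const 1)) <|
  .seq (.setN 9 (.const 0) (.const 1)) <|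
  .seq (.forLoop 7 numEdges scanBody) <|
  .seq (.setN 4 (.var 6) (.var 8))
    (.setN 3 (.var 6) (.sub (.add (.var 8) (.var 9)) (.const 1)))

/-- Update all edges, repeatedly. -/
def sweeps : Prog := .forLoop 5 (.add numEdges numEdges) (.forLoop 6 numEdges updateEdge)

/-- Determine the rounded weight of the edge `e`. -/
def roundWeight : Prog :=
  .seq (.setR 2 (.var 6) (.const 0)) <|
  .ite (.ltR (.const 0) (.cell 0 (.var 6)))
    (.seq (.setR 2 (.var 6) (.cell 3 (.const 0))) <|
     .seq (.loop (.ltR (.cell 0 (.var 6)) (.cell 2 (.var 6)))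
            (.setR 2 (.var 6) (.scale (1 / 4) (.cell 2 (.var 6)))))
          (.loop (.leR (.scale 4 (.cell 2 (.var 6))) (.cell 0 (.var 6)))
            (.setR 2 (.var 6) (.scale 4 (.cell 2 (.var 6))))))
    .skip

/-- Draw the shift of the scale, the ranks of all edges, and round the weights. -/
def prepare : Prog :=
  .seq (.sample 3 (.const 0)) <|
  .seq (.setR 3 (.const 0) (.add (.const 1) (.scale 3 (.cell 3 (.const 0))))) <|
  .forLoop 6 numEdges (.seq (.sample 1 (.var 6)) roundWeight)

/-- The matching algorithm. -/
def matchProg : Prog := .seq prepare sweeps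

/-! ### Correctness of the sweeps -/

/-- The memory contains the graph. -/
structure HasGraph (G : EdgeList) (s : State) : Prop where
  num : s.nat 0 1 = G.m
  src : ∀ e : Fin G.m, s.nat 1 e = G.src e
  tgt : ∀ e : Fin G.m, s.nat 2 e = G.tgt e

/-- The memory contains the graph, the rounded weights `c` and the ranks `r`. -/
structure Ready (G : EdgeList) (c r : Fin G.m → ℝ) (s : State) : Prop extends HasGraph G s where
  rank : ∀ e : Fin G.m, s.real 1 e = r e
  scaled : ∀ e : Fin G.m, s.real 2 e = c e

section Sweeps

variable {G : EdgeList} {c r : Fin G.m → ℝ}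

theorem HasGraph.store_nat {s : State} (h : HasGraph G s) {a i v : ℕ} (ha : 3 ≤ a) :
    HasGraph G { s with nat := store s.nat a i v } := by
  have h0 : ¬ 0 = a := by omega
  have h1 : ¬ 1 = a := by omega
  have h2 : ¬ 2 = a := by omega
  constructor <;> simp [store_apply, h0, h1, h2, h.num, h.src, h.tgt]

theorem Ready.store_nat {s : State} (h : Ready G c r s) {a i v : ℕ} (ha : 3 ≤ a) :
    Ready G c r { s with nat := store s.nat a i v } :=
  { h.toHasGraph.store_nat ha with rank := h.rank, scaled := h.scaled }

open Classical in
/-- The number of edges that precede `e`. -/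
def rankPos (G : EdgeList) (r : Fin G.m → ℝ) (e : Fin G.m) : ℕ :=
  (Finset.univ.filter fun f => G.before r f e).card

open Classical in
/-- The number of edges in larger classes. -/
def levelPos (G : EdgeList) (c : Fin G.m → ℝ) (e : Fin G.m) : ℕ :=
  (Finset.univ.filter fun f => c e < c f).card

theorem rankPos_lt {e f : Fin G.m} (h : G.before r f e) : rankPos G r f < rankPos G r e := by
  classical
  refine Finset.card_lt_card (Finset.ssubset_iff_of_subset (fun g hg => ?_) |>.2 ⟨f, ?_, ?_⟩)
  · exact Finset.mem_filter.2 ⟨Finset.mem_univ _,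
      EdgeList.before_trans (Finset.mem_filter.1 hg).2 h⟩
  · exact Finset.mem_filter.2 ⟨Finset.mem_univ _, h⟩
  · exact fun h' => EdgeList.before_irrefl r f (Finset.mem_filter.1 h').2

theorem levelPos_lt {e f : Fin G.m} (h : c e < c f) : levelPos G c f < levelPos G c e := by
  classical
  refine Finset.card_lt_card (Finset.ssubset_iff_of_subset (fun g hg => ?_) |>.2 ⟨f, ?_, ?_⟩)
  · exact Finset.mem_filter.2 ⟨Finset.mem_univ _, h.trans (Finset.mem_filter.1 hg).2⟩
  · exact Finset.mem_filter.2 ⟨Finset.mem_univ _, h⟩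
  · exact fun h' => lt_irrefl _ (Finset.mem_filter.1 h').2

theorem rankPos_lt_m (r : Fin G.m → ℝ) (e : Fin G.m) : rankPos G r e < G.m := by
  classical
  conv_rhs => rw [← Fintype.card_fin G.m]
  refine Finset.card_lt_univ_of_notMem (x := e) fun h => ?_
  exact EdgeList.before_irrefl r e (Finset.mem_filter.1 h).2

theorem levelPos_lt_m (c : Fin G.m → ℝ) (e : Fin G.m) : levelPos G c e < G.m := by
  classical
  conv_rhs => rw [← Fintype.card_fin G.m]
  refine Finset.card_lt_univ_of_notMem (x := e) fun h => ?_
  exact lt_irrefl _ (Finset.mem_filter.1 h).2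

/-- During sweep `k`, before the update of edge `i`, the status of an edge whose position is less
than `k` is correct; so is that of the edges of position `k` that have been updated. -/
structure Settled (G : EdgeList) (c r : Fin G.m → ℝ) (k i : ℕ) (s : State) : Prop where
  cls : ∀ e : Fin G.m, (rankPos G r e < k ∨ rankPos G r e ≤ k ∧ (e : ℕ) < i) →
    (s.nat 4 e ≠ 0 ↔ e ∈ G.classSel c r)
  lvl : ∀ e : Fin G.m, (G.m + levelPos G c e < k ∨ G.m + levelPos G c e ≤ k ∧ (e : ℕ) < i) →
    (s.nat 3 e ≠ 0 ↔ e ∈ G.select c r)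

theorem Settled.store_nat {k i : ℕ} {s : State} (h : Settled G c r k i s) {a j v : ℕ}
    (ha : 5 ≤ a) : Settled G c r k i { s with nat := store s.nat a j v } := by
  have h3 : ¬ 3 = a := by omega
  have h4 : ¬ 4 = a := by omega
  constructor
  · simpa [store_apply, h4] using h.cls
  · simpa [store_apply, h3] using h.lvl

/-- The state during sweep `k`, before the update of edge `i`. -/
structure SweepState (G : EdgeList) (c r : Fin G.m → ℝ) (k i : ℕ) (s : State) : Prop
    extends Ready G c r s, Settled G c r k i s where
  outer : s.nat 5 0 = k
  inner : s.nat 6 0 = i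

/-- The state during sweep `k` and the update of edge `e`, before edge `j` is considered. -/
structure ScanState (G : EdgeList) (c r : Fin G.m → ℝ) (k : ℕ) (e : Fin G.m) (j : ℕ) (s : State) :
    Prop extends SweepState G c r k e s where
  scan : s.nat 7 0 = j
  flagA : s.nat 8 0 ≤ 1
  flagB : s.nat 9 0 ≤ 1
  flagA_iff : s.nat 8 0 ≠ 0 ↔ ∀ f : Fin G.m, (f : ℕ) < j → G.classBlock c r f e → s.nat 4 f = 0
  flagB_iff : s.nat 9 0 ≠ 0 ↔ ∀ f : Fin G.m, (f : ℕ) < j → G.levelBlock c f e → s.nat 3 f = 0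

theorem not_disjoint_ends {f e : Fin G.m} : ¬ Disjoint (G.ends f) (G.ends e) ↔
    (((G.src f : ℕ) = G.src e ∨ (G.src f : ℕ) = G.tgt e) ∨
      ((G.tgt f : ℕ) = G.src e ∨ (G.tgt f : ℕ) = G.tgt e)) := by
  simp only [EdgeList.ends, Finset.not_disjoint_iff, Finset.mem_insert, Finset.mem_singleton,
    Fin.val_inj]
  constructor
  · rintro ⟨v, rfl | rfl, h⟩ <;> tauto
  · rintro (h | h)
    · exact ⟨_, Or.inl rfl, h⟩
    · exact ⟨_, Or.inr rfl, h⟩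

theorem holds_overlapTest {s : State} (h : HasGraph G s) {e f : Fin G.m} (he : s.nat 6 0 = e)
    (hf : s.nat 7 0 = f) : overlapTest.holds s ↔ ¬ Disjoint (G.ends f) (G.ends e) := by
  simp only [overlapTest, holds_disj, holds_eqN, NExpr.eval, NExpr.var, he, hf, h.src, h.tgt,
    not_disjoint_ends]

theorem holds_beforeTest {s : State} (h : Ready G c r s) {e f : Fin G.m} (he : s.nat 6 0 = e)
    (hf : s.nat 7 0 = f) : beforeTest.holds s ↔ G.before r f e := by
  simp only [beforeTest, holds_disj, holds_conj, holds_ltR, holds_leR, holds_ltN, NExpr.eval,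
    RExpr.eval, NExpr.var, he, hf, h.rank, EdgeList.before, Fin.lt_def]

theorem holds_classTest {s : State} (h : Ready G c r s) {e f : Fin G.m} (he : s.nat 6 0 = e)
    (hf : s.nat 7 0 = f) : classTest.holds s ↔ G.classBlock c r f e ∧ s.nat 4 f ≠ 0 := by
  simp only [classTest, holds_conj, holds_eqR, holds_ltN, holds_overlapTest h.toHasGraph he hf,
    holds_beforeTest h he hf, NExpr.eval, RExpr.eval, NExpr.var, he, hf, h.scaled,
    EdgeList.classBlock, EdgeList.Adj, Nat.pos_iff_ne_zero]
  -- The test does not check `f ≠ e`; this follows because no edge precedes itself.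
  constructor
  · rintro ⟨⟨⟨h1, h2⟩, h3⟩, h4⟩
    exact ⟨⟨⟨⟨by rintro rfl; exact EdgeList.before_irrefl _ _ h3, h1⟩, h2⟩, h3⟩, h4⟩
  · rintro ⟨⟨⟨⟨_, h1⟩, h2⟩, h3⟩, h4⟩
    exact ⟨⟨⟨h1, h2⟩, h3⟩, h4⟩

theorem holds_levelTest {s : State} (h : Ready G c r s) {e f : Fin G.m} (he : s.nat 6 0 = e)
    (hf : s.nat 7 0 = f) : levelTest.holds s ↔ G.levelBlock c f e ∧ s.nat 3 f ≠ 0 := by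
  simp only [levelTest, holds_conj, holds_ltR, holds_ltN, holds_overlapTest h.toHasGraph he hf,
    NExpr.eval, RExpr.eval, NExpr.var, he, hf, h.scaled,
    EdgeList.levelBlock, EdgeList.Adj, Nat.pos_iff_ne_zero]
  constructor
  · rintro ⟨⟨h1, h2⟩, h3⟩
    exact ⟨⟨⟨by rintro rfl; exact lt_irrefl _ h2, h1⟩, h2⟩, h3⟩
  · rintro ⟨⟨⟨_, h1⟩, h2⟩, h3⟩
    exact ⟨⟨h1, h2⟩, h3⟩

theorem SweepState.store_nat {k i : ℕ} {s : State} (h : SweepState G c r k i s) {a j v : ℕ}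
    (ha : 7 ≤ a) : SweepState G c r k i { s with nat := store s.nat a j v } := by
  have h5 : ¬ 5 = a := by omega
  have h6 : ¬ 6 = a := by omega
  exact { h.toReady.store_nat (by omega), h.toSettled.store_nat (by omega) with
    outer := by simp [store_apply, h5, h.outer]
    inner := by simp [store_apply, h6, h.inner] }

theorem forall_lt_succ_iff {m : ℕ} {p : Fin m → Prop} (f : Fin m) :
    (∀ g : Fin m, (g : ℕ) < f + 1 → p g) ↔ (∀ g : Fin m, (g : ℕ) < f → p g) ∧ p f := by
  constructor
  · exact fun h => ⟨fun g hg => h g (by omega), h f (by omega)⟩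
  · rintro ⟨h1, h2⟩ g hg
    rcases (Nat.lt_succ_iff.1 hg).lt_or_eq with h | h
    · exact h1 g h
    · rwa [Fin.ext h]

/-- A time bound for `scanBody`. -/
def scanTime : ℕ := (1 + classTest.cost + (3 + 1)) + (1 + levelTest.cost + (3 + 1))

theorem runs_scanBody {k : ℕ} {e : Fin G.m} {j : ℕ} (hj : j < G.m) {s : State}
    (h : ScanState G c r k e j s) :
    Runs scanBody s scanTime fun s' => s'.nat 7 0 = j ∧
      ScanState G c r k e (j + 1) { s' with nat := store s'.nat 7 0 (j + 1) } := by
  obtain ⟨f, rfl⟩ : ∃ f : Fin G.m, (f : ℕ) = j := ⟨⟨j, hj⟩, rfl⟩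
  have hA := h.flagA_iff
  have hB := h.flagB_iff
  have hA' := h.flagA
  have hB' := h.flagB
  refine Runs.seq (Q := fun s' => SweepState G c r k e s' ∧ s'.nat 7 0 = f ∧ s'.nat 8 0 ≤ 1 ∧
    s'.nat 9 0 ≤ 1 ∧ (s'.nat 8 0 ≠ 0 ↔
      ∀ g : Fin G.m, (g : ℕ) < f + 1 → G.classBlock c r g e → s'.nat 4 g = 0) ∧
    (s'.nat 9 0 ≠ 0 ↔
      ∀ g : Fin G.m, (g : ℕ) < f → G.levelBlock c g e → s'.nat 3 g = 0)) ?_ ?_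
  · refine Runs.ite (T := 3) (T' := 1) (fun hb => Runs.setN ?_) (fun hb => Runs.skip ?_)
    · rw [holds_classTest h.toReady h.inner h.scan] at hb
      refine ⟨h.toSweepState.store_nat (by omega), ?_⟩
      simp only [NExpr.eval, store_apply, forall_lt_succ_iff]
      simp [h.scan, hB, hB', hb]
    · rw [holds_classTest h.toReady h.inner h.scan] at hb
      refine ⟨h.toSweepState, h.scan, hA', hB', ?_, hB⟩
      rw [hA, forall_lt_succ_iff]
      exact ⟨fun h' => ⟨h', fun hc => by by_contra h0; exact hb ⟨hc, h0⟩⟩, And.left⟩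
  · rintro s' ⟨h1, h2, h3, h4, h5, h6⟩
    refine Runs.ite (T := 3) (T' := 1) (fun hb => Runs.setN ?_) (fun hb => Runs.skip ?_)
    · rw [holds_levelTest h1.toReady h1.inner h2] at hb
      refine ⟨by simp [store_apply, h2],
        { (h1.store_nat (by omega)).store_nat (by omega) with
          scan := by simp [store_apply]
          flagA := by simpa [store_apply] using h3
          flagB := by simp [store_apply, NExpr.eval]
          flagA_iff := by simpa [store_apply] using h5
          flagB_iff := ?_ }⟩
      simp only [NExpr.eval, store_apply, forall_lt_succ_iff]
      simp [hb]
    · rw [holds_levelTest h1.toReady h1.inner h2] at hb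
      refine ⟨h2,
        { h1.store_nat (by omega) with
          scan := by simp [store_apply]
          flagA := by simpa [store_apply] using h3
          flagB := by simpa [store_apply] using h4
          flagA_iff := by simpa [store_apply] using h5
          flagB_iff := ?_ }⟩
      simp only [store_apply, forall_lt_succ_iff, Nat.reduceEqDiff, false_and, if_false]
      rw [h6]
      exact ⟨fun h' => ⟨h', fun hc => by by_contra h0; exact hb ⟨hc, h0⟩⟩, And.left⟩

/-- A time bound for `updateEdge`. -/
def updateTime (m : ℕ) : ℕ := 3 + (3 + (forTime numEdges m scanTime + (5 + 10)))

theorem runs_updateEdge {k i : ℕ} (hi : i < G.m) {s : State} (h : SweepState G c r k i s) :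
    Runs updateEdge s (updateTime G.m) fun s' => s'.nat 6 0 = i ∧
      SweepState G c r k (i + 1) { s' with nat := store s'.nat 6 0 (i + 1) } := by
  obtain ⟨e, rfl⟩ : ∃ e : Fin G.m, (e : ℕ) = i := ⟨⟨i, hi⟩, rfl⟩
  refine Runs.seq (T := 3) (Runs.setN (Q := fun s' => SweepState G c r k e s' ∧ s'.nat 8 0 = 1)
    ⟨h.store_nat (by omega), by simp [store_apply, NExpr.eval]⟩) ?_
  rintro s1 ⟨h1, f1⟩
  refine Runs.seq (T := 3) (Runs.setN (Q := fun s' => SweepState G c r k e s' ∧ s'.nat 8 0 = 1 ∧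
    s'.nat 9 0 = 1) ⟨h1.store_nat (by omega), by simp [store_apply, NExpr.eval, f1]⟩) ?_
  rintro s2 ⟨h2, f2, f2'⟩
  refine Runs.seq (Runs.forLoop (ScanState G c r k e) G.m ?_
    (fun j s hj hs => runs_scanBody hj hs) ?_) ?_
  · exact fun j s hs => ⟨hs.scan, hs.num⟩
  · exact { h2.store_nat (by omega) with
      scan := by simp [store_apply]
      flagA := by simp [store_apply, f2]
      flagB := by simp [store_apply, f2']
      flagA_iff := by simp [store_apply, f2]
      flagB_iff := by simp [store_apply, f2'] }
  intro s3 h3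
  have hA : s3.nat 8 0 ≠ 0 ↔ ∀ f : Fin G.m, G.classBlock c r f e → s3.nat 4 f = 0 := by
    rw [h3.flagA_iff]
    exact ⟨fun h f => h f f.2, fun h f _ => h f⟩
  have hB : s3.nat 9 0 ≠ 0 ↔ ∀ f : Fin G.m, G.levelBlock c f e → s3.nat 3 f = 0 := by
    rw [h3.flagB_iff]
    exact ⟨fun h f => h f f.2, fun h f _ => h f⟩
  -- All blockers of `e` have smaller position, so the statuses read in the scan are already
  -- correct.
  have hselA : rankPos G r e ≤ k → (s3.nat 8 0 ≠ 0 ↔ e ∈ G.classSel c r) := by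
    intro hk
    rw [hA, EdgeList.isGreedy_classSel c r e, true_and]
    refine forall₂_congr fun f hf => ?_
    have := h3.cls f (Or.inl ((rankPos_lt hf.2).trans_le hk))
    rw [← this, not_not]
  have hselB : G.m + levelPos G c e ≤ k →
      (s3.nat 8 0 + s3.nat 9 0 - 1 ≠ 0 ↔ e ∈ G.select c r) := by
    intro hk
    -- Positions in the rank order are below `m`, so the offset `m` makes the level stage start
    -- after the class matchings are final.
    have hk' : rankPos G r e ≤ k := by
      have := rankPos_lt_m r e
      omega
    -- The flags are 0 or 1, so the truncated difference computes their conjunction.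
    have e1 : s3.nat 8 0 + s3.nat 9 0 - 1 ≠ 0 ↔ s3.nat 8 0 ≠ 0 ∧ s3.nat 9 0 ≠ 0 := by
      have := h3.flagA
      have := h3.flagB
      omega
    rw [e1, hselA hk', hB, EdgeList.select, EdgeList.isGreedy_levelSel c _ e]
    refine and_congr_right fun _ => forall₂_congr fun f hf => ?_
    have hlt := levelPos_lt hf.2
    have := h3.lvl f (Or.inl (by omega))
    rw [EdgeList.select] at this
    rw [← this, not_not]
  refine Runs.seq (T := 5) (T' := 10) (Runs.setN (Q := fun s' => s' = { s3 with
    nat := store s3.nat 4 e (s3.nat 8 0) }) (by simp [NExpr.eval, NExpr.var, h3.inner])) ?_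
  rintro s4 rfl
  refine Runs.setN ?_
  simp only [NExpr.eval, NExpr.var, store_apply, Nat.reduceEqDiff, false_and,
    if_false, h3.inner]
  refine ⟨trivial, ?_⟩
  refine { ((h3.toReady.store_nat (by omega)).store_nat (by omega)).store_nat (by omega) with
    cls := ?_, lvl := ?_, outer := by simp [store_apply, h3.outer], inner := by simp [store_apply] }
  · intro f hf
    simp only [store_apply, Nat.reduceEqDiff, false_and, if_false, true_and]
    by_cases hfe : f = e
    · subst hfe
      rw [if_pos rfl]
      exact hselA (by omega)
    · have hne : (f : ℕ) ≠ e := fun h => hfe (Fin.ext h)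
      rw [if_neg hne]
      exact h3.cls f (by omega)
  · intro f hf
    simp only [store_apply, Nat.reduceEqDiff, false_and, if_false, true_and]
    by_cases hfe : f = e
    · subst hfe
      rw [if_pos rfl]
      exact hselB (by omega)
    · have hne : (f : ℕ) ≠ e := fun h => hfe (Fin.ext h)
      rw [if_neg hne]
      exact h3.lvl f (by omega)

/-- A time bound for `sweeps`. -/
def sweepsTime (m : ℕ) : ℕ :=
  forTime (.add numEdges numEdges) (m + m) (forTime numEdges m (updateTime m))

theorem runs_sweeps {s : State} (h : Ready G c r s) :
    Runs sweeps s (sweepsTime G.m) fun s' => ∀ e : Fin G.m, s'.nat 3 e ≠ 0 ↔ e ∈ G.select c r := by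
  refine (Runs.forLoop (fun k s => Ready G c r s ∧ Settled G c r k 0 s ∧ s.nat 5 0 = k) (G.m + G.m)
    ?_ ?_ ?_).mono le_rfl ?_
  · rintro k s ⟨h1, h2, h3⟩
    refine ⟨h3, ?_⟩
    simp only [NExpr.eval, numEdges, h1.num]
  · rintro k s hk ⟨h1, h2, h3⟩
    refine (Runs.forLoop (SweepState G c r k) G.m ?_ (fun i s hi hs => runs_updateEdge hi hs)
      ?_).mono le_rfl ?_
    · exact fun i s hs => ⟨hs.inner, hs.num⟩
    · exact { h1.store_nat (by omega), h2.store_nat (by omega) with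
        outer := by simp [store_apply, h3]
        inner := by simp [store_apply] }
    · intro s' hs'
      refine ⟨hs'.outer, hs'.toReady.store_nat (by omega), ?_, by simp [store_apply]⟩
      have := hs'.toSettled.store_nat (a := 5) (j := 0) (v := k + 1) (by omega)
      -- Position at most `k` with every edge updated is position less than `k + 1` with none
      -- updated.
      exact ⟨fun e he => this.cls e (by omega), fun e he => this.lvl e (by omega)⟩
  · refine ⟨h.store_nat (by omega), ⟨fun e he => ?_, fun e he => ?_⟩, by simp [store_apply]⟩
    · omega
    · have := e.2
      omega
  · rintro s' ⟨_, h2, _⟩ e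
    exact h2.lvl e (Or.inl (by have := levelPos_lt_m c e; omega))

end Sweeps

/-! ### Correctness of the preparation -/

/-- The random shift of the scale. -/
def shift (ω : ℕ → I) : ℝ := 1 + 3 * (ω 0 : ℝ)

theorem one_le_shift (ω : ℕ → I) : 1 ≤ shift ω := by
  have := (ω 0).2.1
  rw [shift]; linarith

theorem shift_le_four (ω : ℕ → I) : shift ω ≤ 4 := by
  have := (ω 0).2.2
  rw [shift]; linarith

/-- The rounded weights. -/
def roundedWeight (G : EdgeList) (w : G.Weights) (ω : ℕ → I) (e : Fin G.m) : ℝ :=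
  rd (shift ω) (w e)

/-- The random ranks. -/
def rankOf (G : EdgeList) (ω : ℕ → I) (e : Fin G.m) : ℝ := (ω (e + 1) : ℝ)

/-- The output for the random numbers `ω`. -/
def matchOutput (G : EdgeList) (w : G.Weights) (ω : ℕ → I) : Finset (Fin G.m) :=
  G.select (roundedWeight G w ω) (rankOf G ω)

section Prepare

variable {G : EdgeList} {w : G.Weights} {ω : ℕ → I}

/-- The state after the ranks of `i` edges have been drawn. -/
structure Drawn (G : EdgeList) (w : G.Weights) (ω : ℕ → I) (i : ℕ) (s : State) : Prop
    extends HasGraph G s where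
  weight : ∀ e : Fin G.m, s.real 0 e = w e
  shift_eq : s.real 3 0 = shift ω
  tape_eq : ∀ k, s.tape k = ω (k + i + 1)
  rank : ∀ e : Fin G.m, (e : ℕ) < i → s.real 1 e = rankOf G ω e

/-- The state before the preparation of edge `i`. -/
structure PrepState (G : EdgeList) (w : G.Weights) (ω : ℕ → I) (i : ℕ) (s : State) : Prop
    extends Drawn G w ω i s where
  scaled : ∀ e : Fin G.m, (e : ℕ) < i → s.real 2 e = roundedWeight G w ω e
  counter : s.nat 6 0 = i

/-- The state during the rounding of the weight of `e`, where `v` is the current value. -/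
structure RoundState (G : EdgeList) (w : G.Weights) (ω : ℕ → I) (e : Fin G.m) (v : ℝ) (s : State) :
    Prop extends Drawn G w ω (e + 1) s where
  scaled : ∀ f : Fin G.m, (f : ℕ) < e → s.real 2 f = roundedWeight G w ω f
  counter : s.nat 6 0 = e
  current : s.real 2 e = v

theorem RoundState.store_real {e : Fin G.m} {v v' : ℝ} {s : State} (h : RoundState G w ω e v s) :
    RoundState G w ω e v' { s with real := store s.real 2 e v' } := by
  refine { h with weight := ?_, shift_eq := ?_, rank := ?_, scaled := ?_, current := ?_ }
  · simpa [store_apply] using h.weight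
  · simpa [store_apply] using h.shift_eq
  · simpa [store_apply] using h.rank
  · intro f hf
    have : (f : ℕ) ≠ e := hf.ne
    simpa [store_apply, this] using h.scaled f hf
  · simp [store_apply]

/-- A time bound for `roundWeight`. -/
def roundTime (L : ℕ) : ℕ :=
  4 + (1 + 6 + ((5 + ((L + 1 + 1) * (1 + 8 + 7) + (L + 1) * (1 + 8 + 7))) + 1))

theorem pow_bounds_of_logb {v : ℝ} (hv : 0 < v) {L : ℕ} (hL : ⌈|Real.logb 2 v|⌉₊ ≤ L) :
    (1 / 4 : ℝ) ^ L ≤ v ∧ v ≤ 4 ^ L := by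
  have h1 : |Real.logb 2 v| ≤ L := (Nat.le_ceil _).trans (by exact_mod_cast hL)
  obtain ⟨h2, h3⟩ := abs_le.1 h1
  have h4 : v = 2 ^ Real.logb 2 v := (Real.rpow_logb (by norm_num) (by norm_num) hv).symm
  constructor
  · calc (1 / 4 : ℝ) ^ L ≤ (1 / 2) ^ L := pow_le_pow_left₀ (by norm_num) (by norm_num) L
      _ = (2 : ℝ) ^ (-(L : ℝ)) := by
          rw [Real.rpow_neg (by norm_num), Real.rpow_natCast, one_div, inv_pow]
      _ ≤ 2 ^ Real.logb 2 v := Real.rpow_le_rpow_of_exponent_le (by norm_num) h2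
      _ = v := h4.symm
  · calc v = 2 ^ Real.logb 2 v := h4
      _ ≤ (2 : ℝ) ^ (L : ℝ) := Real.rpow_le_rpow_of_exponent_le (by norm_num) h3
      _ = 2 ^ L := Real.rpow_natCast _ _
      _ ≤ 4 ^ L := pow_le_pow_left₀ (by norm_num) (by norm_num) L

/-- Dividing by 4 while the value exceeds the weight, then multiplying by 4 while possible, ends at
the grid point in (w/4, w]. If a division has taken place, `w < 4 * v` already holds and the second
loop does nothing. -/
theorem runs_roundWeight {e : Fin G.m} {v : ℝ} {s : State} {L : ℕ}
    (hL : ⌈|Real.logb 2 (w e : ℝ)|⌉₊ ≤ L) (h : RoundState G w ω e v s) :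
    Runs roundWeight s (roundTime L) (RoundState G w ω e (roundedWeight G w ω e)) := by
  have hx1 := one_le_shift ω
  have hx4 := shift_le_four ω
  refine Runs.seq (T := 4) (Runs.setR (Q := RoundState G w ω e 0) ?_) ?_
  · simpa [NExpr.eval, NExpr.var, h.counter, RExpr.eval] using h.store_real (v' := 0)
  intro s1 h1
  refine Runs.ite (fun hb => ?_) (fun hb => Runs.skip ?_)
  swap
  · rw [holds_ltR, RExpr.eval, RExpr.eval, NExpr.var, NExpr.eval, NExpr.eval, h1.counter,
      h1.weight] at hb
    rw [Rat.cast_zero, not_lt] at hb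
    have : (w e : ℝ) = 0 := le_antisymm hb (w e).2
    rwa [roundedWeight, this, rd_zero]
  rw [holds_ltR, RExpr.eval, RExpr.eval, NExpr.var, NExpr.eval, NExpr.eval, h1.counter,
    h1.weight, Rat.cast_zero] at hb
  obtain ⟨hlo, hhi⟩ := pow_bounds_of_logb hb hL
  refine Runs.seq (T := 5) (Runs.setR (Q := RoundState G w ω e (shift ω)) ?_) ?_
  · simpa [NExpr.eval, NExpr.var, h1.counter, RExpr.eval, h1.shift_eq] using
      h1.store_real (v' := shift ω)
  intro s2 h2
  refine Runs.seq (Runs.loop (fun j s => RoundState G w ω e (shift ω * (1 / 4) ^ j) s ∧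
    (j = 0 ∨ (w e : ℝ) < 4 * (shift ω * (1 / 4) ^ j))) (L + 1) (T := 7) ?_ ?_) ?_
  · rintro j s ⟨hj, hj'⟩ hc
    rw [holds_ltR, RExpr.eval, RExpr.eval, NExpr.var, NExpr.eval, NExpr.eval, hj.counter,
      hj.weight, hj.current] at hc
    constructor
    -- The shift can be as large as 4, which costs one division beyond `L`.
    · by_contra hlt
      have : (1 / 4 : ℝ) ^ j ≤ (1 / 4) ^ (L + 1) :=
        pow_le_pow_of_le_one (by norm_num) (by norm_num) (not_lt.1 hlt)
      rw [pow_succ] at this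
      have h0 : (0 : ℝ) ≤ (1 / 4) ^ j := by positivity
      nlinarith
    · refine Runs.setR ?_
      simp only [NExpr.eval, NExpr.var, RExpr.eval, hj.counter, hj.current]
      have : (((1 / 4 : ℚ) : ℝ) * (shift ω * (1 / 4) ^ j)) = shift ω * (1 / 4) ^ (j + 1) := by
        push_cast; ring
      rw [this]
      exact ⟨hj.store_real, Or.inr (by rw [pow_succ]; linarith)⟩
  · exact ⟨by simpa using h2, Or.inl rfl⟩
  rintro s3 ⟨j, ⟨h3, hj⟩, hc⟩
  rw [holds_ltR, RExpr.eval, RExpr.eval, NExpr.var, NExpr.eval, NExpr.eval, h3.counter,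
      h3.weight, h3.current, not_lt] at hc
  refine (Runs.loop (fun i s => RoundState G w ω e (shift ω * (1 / 4) ^ j * 4 ^ i) s ∧
    shift ω * (1 / 4) ^ j * 4 ^ i ≤ (w e : ℝ)) L (T := 7) ?_ ?_).mono le_rfl ?_
  · rintro i s ⟨hi, hi'⟩ hc'
    rw [holds_leR, RExpr.eval, RExpr.eval, RExpr.eval, NExpr.var, NExpr.eval, NExpr.eval,
      hi.counter, hi.weight, hi.current, Rat.cast_ofNat] at hc'
    have h1i : (1 : ℝ) ≤ 4 ^ i := one_le_pow₀ (by norm_num)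
    constructor
    · rcases hj with rfl | hj
      · by_contra hlt
        have : (4 : ℝ) ^ L ≤ 4 ^ i := pow_le_pow_right₀ (by norm_num) (not_lt.1 hlt)
        have : (0 : ℝ) < 4 ^ L := by positivity
        rw [pow_zero, mul_one] at hc'
        nlinarith
      · have : 0 < shift ω * (1 / 4) ^ j := by positivity
        nlinarith
    · refine Runs.setR ?_
      simp only [NExpr.eval, NExpr.var, RExpr.eval, hi.counter, hi.current]
      have : (((4 : ℚ) : ℝ) * (shift ω * (1 / 4) ^ j * 4 ^ i)) =
          shift ω * (1 / 4) ^ j * 4 ^ (i + 1) := by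
        push_cast; ring
      rw [this]
      exact ⟨hi.store_real, by rw [pow_succ]; linarith⟩
  · exact ⟨by simpa using h3, by simpa using hc⟩
  · rintro s4 ⟨i, ⟨h4, hi⟩, hc'⟩
    rw [holds_leR, RExpr.eval, RExpr.eval, RExpr.eval, NExpr.var, NExpr.eval, NExpr.eval,
      h4.counter, h4.weight, h4.current, Rat.cast_ofNat, not_le] at hc'
    have hz : shift ω * (1 / 4) ^ j * 4 ^ i = shift ω * (4 : ℝ) ^ ((i : ℤ) - j) := by
      rw [zpow_sub₀ (by norm_num), zpow_natCast, zpow_natCast, one_div, inv_pow]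
      field_simp
    rwa [eq_rd hx1 hx4 hb hz hi hc', ← roundedWeight] at h4

/-- A time bound for `prepare`. -/
def prepareTime (m L : ℕ) : ℕ := 2 + (7 + forTime numEdges m (3 + roundTime L))

theorem runs_prepare {L : ℕ} (hL : ∀ e, ⌈|Real.logb 2 (w e : ℝ)|⌉₊ ≤ L) :
    Runs prepare (inputState G w ω) (prepareTime G.m L)
      (Ready G (roundedWeight G w ω) (rankOf G ω)) := by
  refine Runs.seq (T := 2) (Runs.sample rfl) ?_
  rintro s1 rfl
  refine Runs.seq (T := 7) (Runs.setR rfl) ?_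
  rintro s2 rfl
  refine (Runs.forLoop (PrepState G w ω) G.m ?_ ?_ ?_).mono le_rfl ?_
  · exact fun i s hs => ⟨hs.counter, hs.num⟩
  · intro i s hi hs
    obtain ⟨e, rfl⟩ : ∃ e : Fin G.m, (e : ℕ) = i := ⟨⟨i, hi⟩, rfl⟩
    refine Runs.seq (T := 3) (Runs.sample (Q := fun s' => ∃ v, RoundState G w ω e v s') ?_) ?_
    · refine ⟨_, { hs with weight := ?_, shift_eq := ?_, rank := ?_, scaled := ?_, tape_eq := ?_,
                           current := rfl }⟩
      · simpa [store_apply] using hs.weight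
      · simpa [store_apply] using hs.shift_eq
      · intro k
        simp only [hs.tape_eq]
        congr 1
        omega
      · intro f hf
        simp only [NExpr.eval, NExpr.var, hs.counter, store_apply, true_and]
        split_ifs with hfe
        · rw [hs.tape_eq, rankOf, hfe, zero_add]
        · exact hs.rank f (by omega)
      · simpa [store_apply] using hs.scaled
    · rintro s1 ⟨v, h1⟩
      refine (runs_roundWeight (hL e) h1).mono le_rfl fun s' h' => ⟨h'.counter, ?_⟩
      refine { h' with toHasGraph := h'.toHasGraph.store_nat (by omega), scaled := ?_,
                       counter := by simp [store_apply] }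
      intro f hf
      rcases (Nat.lt_succ_iff.1 hf).lt_or_eq with hlt | heq
      · exact h'.scaled f hlt
      · rw [Fin.ext heq]
        exact h'.current
  · refine { num := ?_, src := ?_, tgt := ?_, weight := ?_, shift_eq := ?_, tape_eq := ?_,
             rank := ?_, scaled := ?_, counter := ?_ }
    all_goals simp [store_apply, inputState, NExpr.eval, RExpr.eval, shift]
  · intro s hs
    exact { hs.toHasGraph with
      rank := fun e => hs.rank e e.2
      scaled := fun e => hs.scaled e e.2 }

theorem runs_matchProg {L : ℕ} (hL : ∀ e, ⌈|Real.logb 2 (w e : ℝ)|⌉₊ ≤ L) :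
    Runs matchProg (inputState G w ω) (prepareTime G.m L + sweepsTime G.m)
      fun s => outputSet G s = matchOutput G w ω := by
  refine (Runs.seq (runs_prepare hL) fun s hs => runs_sweeps hs).mono le_rfl fun s hs => ?_
  ext e
  simp only [outputSet, Finset.mem_filter, Finset.mem_univ, true_and, hs e, matchOutput]

theorem ceil_logb_le_inputSize (G : EdgeList) (w : G.Weights) (e : Fin G.m) :
    ⌈|Real.logb 2 (w e : ℝ)|⌉₊ ≤ G.inputSize w :=
  (Finset.single_le_sum (f := fun e => ⌈|Real.logb 2 (w e : ℝ)|⌉₊) (fun _ _ => Nat.zero_le _)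
    (Finset.mem_univ e)).trans (Nat.le_add_left _ _)

theorem returns_matchProg (G : EdgeList) (w : G.Weights) (ω : ℕ → I) (F : Finset (Fin G.m)) :
    Returns matchProg G w ω F ↔ matchOutput G w ω = F := by
  obtain ⟨t, s', h1, _, h3⟩ := runs_matchProg (ω := ω) (ceil_logb_le_inputSize G w)
  constructor
  · rintro ⟨t', s'', h1', h3'⟩
    rw [← h3', ← h3, (h1.unique h1').2]
  · rintro rfl
    exact ⟨t, s', h1, h3⟩

end Prepare

/-! ### Polynomial time -/

/-- Functions that are given by a polynomial. -/
def IsPoly (f : ℕ → ℕ) : Prop := ∃ p : Polynomial ℕ, ∀ N, p.eval N = f N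

namespace IsPoly

theorem const (k : ℕ) : IsPoly fun _ => k := ⟨.C k, fun _ => Polynomial.eval_C⟩

theorem id : IsPoly fun N => N := ⟨.X, fun _ => Polynomial.eval_X⟩

theorem add {f g : ℕ → ℕ} (hf : IsPoly f) (hg : IsPoly g) : IsPoly fun N => f N + g N := by
  obtain ⟨p, hp⟩ := hf
  obtain ⟨q, hq⟩ := hg
  exact ⟨p + q, fun N => by rw [Polynomial.eval_add, hp, hq]⟩

theorem mul {f g : ℕ → ℕ} (hf : IsPoly f) (hg : IsPoly g) : IsPoly fun N => f N * g N := by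
  obtain ⟨p, hp⟩ := hf
  obtain ⟨q, hq⟩ := hg
  exact ⟨p * q, fun N => by rw [Polynomial.eval_mul, hp, hq]⟩

theorem forTime (x : NExpr) {f g : ℕ → ℕ} (hf : IsPoly f) (hg : IsPoly g) :
    IsPoly fun N => LipMatching.forTime x (f N) (g N) :=
  (const 3).add ((hf.add (const 1)).mul ((const _).add (hg.add (const 6))))

theorem roundTime : IsPoly roundTime :=
  (const 4).add ((const _).add (((const 5).add ((((id.add (const 1)).add (const 1)).mul
    (const _)).add ((id.add (const 1)).mul (const _)))).add (const 1)))

theorem prepareTime : IsPoly fun N => prepareTime N N :=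
  (const 2).add ((const 7).add (forTime _ id ((const 3).add roundTime)))

theorem sweepsTime : IsPoly sweepsTime :=
  forTime _ (id.add id) (forTime _ id ((const 3).add ((const 3).add
    ((forTime _ id (const scanTime)).add (const _)))))

end IsPoly

theorem forTime_mono (x : NExpr) {N N' T T' : ℕ} (hN : N ≤ N') (hT : T ≤ T') :
    forTime x N T ≤ forTime x N' T' := by
  unfold forTime
  gcongr

theorem prepareTime_mono {m m' L L' : ℕ} (hm : m ≤ m') (hL : L ≤ L') :
    prepareTime m L ≤ prepareTime m' L' := by
  have hr : roundTime L ≤ roundTime L' := by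
    unfold roundTime
    gcongr
  unfold prepareTime
  have := forTime_mono numEdges hm (add_le_add_right hr 3)
  omega

theorem sweepsTime_mono {m m' : ℕ} (hm : m ≤ m') : sweepsTime m ≤ sweepsTime m' := by
  refine forTime_mono _ (by omega) (forTime_mono _ hm ?_)
  have := forTime_mono numEdges hm (le_refl scanTime)
  unfold updateTime
  omega

theorem polyTime_matchProg : PolyTime matchProg := by
  obtain ⟨p, hp⟩ := IsPoly.prepareTime.add IsPoly.sweepsTime
  refine ⟨p, fun G w ω => ?_⟩
  obtain ⟨t, s', h1, h2, -⟩ := runs_matchProg (ω := ω) (ceil_logb_le_inputSize G w)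
  refine ⟨t, s', h1, h2.trans ?_⟩
  have hm : G.m ≤ G.inputSize w := by
    unfold EdgeList.inputSize
    omega
  rw [hp]
  exact add_le_add (prepareTime_mono hm le_rfl) (sweepsTime_mono hm)

/-! ### The law of the output -/

instance : IsProbabilityMeasure uniformTape := by unfold uniformTape; infer_instance

/-- All sets of edge sets are measurable. -/
instance edgeSetMeasurableSpace (m : ℕ) : MeasurableSpace (Finset (Fin m)) := ⊤

instance (m : ℕ) : DiscreteMeasurableSpace (Finset (Fin m)) := ⟨fun _ => trivial⟩

theorem measurable_tape_coe (i : ℕ) : Measurable fun ω : ℕ → I => (ω i : ℝ) :=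
  measurable_subtype_coe.comp (measurable_pi_apply i)

theorem measurable_shift : Measurable shift :=
  ((measurable_tape_coe 0).const_mul 3).const_add 1

variable {G : EdgeList}

theorem measurable_roundedWeight (w : G.Weights) (e : Fin G.m) :
    Measurable fun ω => roundedWeight G w ω e :=
  (measurable_rd _).comp measurable_shift

/-- The tape enters only through finitely many comparisons: the output factors through a pair of
relations on the edges, which ranges over a finite discrete space. -/
theorem measurable_matchOutput (w : G.Weights) : Measurable (matchOutput G w) := by
  obtain ⟨g, hg'⟩ : ∃ g : (Fin G.m → Fin G.m → Prop) × (Fin G.m → Fin G.m → Prop) →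
      Finset (Fin G.m), g = fun R => greedy (· ∈ greedy (fun _ => True) R.1) R.2 := ⟨_, rfl⟩
  have hg : Measurable g := Measurable.of_discrete
  have hc := measurable_roundedWeight w
  have hr : ∀ e, Measurable fun ω => rankOf G ω e := fun e => measurable_tape_coe _
  have hR : Measurable fun ω => (G.classBlock (roundedWeight G w ω) (rankOf G ω),
      G.levelBlock (roundedWeight G w ω)) := by
    refine Measurable.prodMk ?_ ?_
    · refine measurable_pi_lambda _ fun f => measurable_pi_lambda _ fun e => ?_
      refine Measurable.and (Measurable.and measurable_const ?_) (Measurable.or ?_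
        (Measurable.and ?_ measurable_const))
      · exact measurableSet_setOfPred.1 (measurableSet_eq_fun (hc f) (hc e))
      · exact measurableSet_setOfPred.1 (measurableSet_lt (hr f) (hr e))
      · exact measurableSet_setOfPred.1 (measurableSet_le (hr f) (hr e))
    · refine measurable_pi_lambda _ fun f => measurable_pi_lambda _ fun e => ?_
      exact Measurable.and measurable_const
        (measurableSet_setOfPred.1 (measurableSet_lt (hc e) (hc f)))
  have h := hg.comp hR
  rw [hg'] at h
  exact h

section Law

variable {α β : Type} [MeasurableSpace α] [MeasurableSpace β]

/-- The law of a discrete random variable on the space of random tapes. -/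
def lawOf [Countable α] [MeasurableSingletonClass α] {f : (ℕ → I) → α} (hf : Measurable f) :
    PMF α :=
  haveI := Measure.isProbabilityMeasure_map (μ := uniformTape) hf.aemeasurable
  (uniformTape.map f).toPMF

variable [Countable α] [MeasurableSingletonClass α] [Countable β] [MeasurableSingletonClass β]
  {f : (ℕ → I) → α} (hf : Measurable f)

theorem lawOf_apply (x : α) : lawOf hf x = uniformTape {ω | f ω = x} := by
  have := Measure.isProbabilityMeasure_map (μ := uniformTape) hf.aemeasurable
  rw [lawOf, Measure.toPMF_apply, Measure.map_apply hf (measurableSet_singleton x)]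
  rfl

theorem toMeasure_lawOf : (lawOf hf).toMeasure = uniformTape.map f := by
  have := Measure.isProbabilityMeasure_map (μ := uniformTape) hf.aemeasurable
  rw [lawOf, Measure.toPMF_toMeasure]

theorem map_lawOf {g : α → β} (hg : Measurable g) : (lawOf hf).map g = lawOf (hg.comp hf) := by
  refine PMF.toMeasure_injective ?_
  rw [← PMF.toMeasure_map g _ hg, toMeasure_lawOf, toMeasure_lawOf, Measure.map_map hg hf]

end Law

/-- Reading both outputs from the same tape is a coupling. -/
theorem earthMover_lawOf_le {f f' : (ℕ → I) → Finset (Fin G.m)} (hf : Measurable f)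
    (hf' : Measurable f') (w w' : G.Weights) :
    G.earthMover (lawOf hf) w (lawOf hf') w' ≤
      ∫⁻ ω, ENNReal.ofReal (G.dw (f ω) w (f' ω) w') ∂uniformTape := by
  have hff : Measurable fun ω => (f ω, f' ω) := hf.prodMk hf'
  refine (iInf₂_le (lawOf hff) ⟨map_lawOf hff measurable_fst, map_lawOf hff measurable_snd⟩).trans ?_
  have h := lintegral_map (μ := uniformTape)
    (f := fun x : Finset (Fin G.m) × Finset (Fin G.m) => ENNReal.ofReal (G.dw x.1 w x.2 w'))
    Measurable.of_discrete hff
  rw [← h, ← toMeasure_lawOf hff, lintegral_fintype]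
  refine le_of_eq (Finset.sum_congr rfl fun x _ => ?_)
  rw [PMF.toMeasure_apply_singleton _ _ (measurableSet_singleton x), mul_comm]

theorem sum_lawOf_toReal_mul {f : (ℕ → I) → Finset (Fin G.m)} (hf : Measurable f)
    (g : Finset (Fin G.m) → ℝ) :
    ∑ F, (lawOf hf F).toReal * g F = ∫ ω, g (f ω) ∂uniformTape := by
  have h := PMF.integral_eq_sum (lawOf hf) g
  rw [toMeasure_lawOf, integral_map hf.aemeasurable
    (Measurable.of_discrete : Measurable g).aestronglyMeasurable] at h
  rw [h]
  rfl

theorem integrable_comp_edgeSet {f : (ℕ → I) → Finset (Fin G.m)} (hf : Measurable f)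
    (g : Finset (Fin G.m) → ℝ) : Integrable (fun ω => g (f ω)) uniformTape :=
  (Integrable.of_finite (μ := uniformTape.map f) (f := g)).comp_measurable hf

/-! ### Expectations of rounded weights -/

theorem map_tape_coe : uniformTape.map (fun ω => (ω 0 : ℝ)) = volume.restrict (Set.Icc 0 1) :=
  (unitInterval.measurePreserving_coe.comp
    (measurePreserving_eval_infinitePi (fun _ : ℕ => (volume : Measure I)) 0)).map_eq

theorem integral_roundedWeight (w : G.Weights) (e : Fin G.m) :
    ∫ ω, roundedWeight G w ω e ∂uniformTape = rdMean (w e) := by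
  have hw : (0 : ℝ) ≤ w e := (w e).2
  have hm : Measurable fun u : ℝ => rd (1 + 3 * u) (w e) :=
    (measurable_rd _).comp (by fun_prop)
  have h := integral_map (μ := uniformTape) (measurable_tape_coe 0).aemeasurable
    hm.aestronglyMeasurable
  rw [map_tape_coe] at h
  rw [← integral_rd hw, intervalIntegral.integral_of_le zero_le_one,
    ← integral_Icc_eq_integral_Ioc, h]
  rfl

theorem roundedWeight_nonneg (w : G.Weights) (ω : ℕ → I) (e : Fin G.m) :
    0 ≤ roundedWeight G w ω e := rd_nonneg (one_le_shift ω) (shift_le_four ω) (w e).2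

theorem roundedWeight_le (w : G.Weights) (ω : ℕ → I) (e : Fin G.m) :
    roundedWeight G w ω e ≤ w e := rd_le (one_le_shift ω) (shift_le_four ω) (w e).2

theorem le_four_mul_roundedWeight (w : G.Weights) (ω : ℕ → I) (e : Fin G.m) :
    (w e : ℝ) ≤ 4 * roundedWeight G w ω e :=
  le_four_mul_rd (one_le_shift ω) (shift_le_four ω) (w e).2

theorem separated_roundedWeight (w : G.Weights) (ω : ℕ → I) : Separated (roundedWeight G w ω) :=
  fun e f h => four_mul_rd_le (one_le_shift ω) (shift_le_four ω) (w e).2 (w f).2 h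

theorem integrable_roundedWeight (w : G.Weights) (e : Fin G.m) :
    Integrable (fun ω => roundedWeight G w ω e) uniformTape := by
  refine Integrable.of_bound (measurable_roundedWeight w e).aestronglyMeasurable (w e)
    (ae_of_all _ fun ω => ?_)
  rw [Real.norm_of_nonneg (roundedWeight_nonneg w ω e)]
  exact roundedWeight_le w ω e

/-! ### Approximation -/

theorem exists_isMatching_weight_eq_opt (w : G.Weights) :
    ∃ O, G.IsMatching O ∧ G.opt w = G.weight w O := by
  classical
  obtain ⟨O, hO, h⟩ := Finset.exists_mem_eq_sup
    (Finset.univ.filter fun M : Finset (Fin G.m) => G.IsMatching M)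
    ⟨∅, Finset.mem_filter.2 ⟨Finset.mem_univ _, fun e he => absurd he (Finset.notMem_empty e)⟩⟩ (G.weight w)
  refine ⟨O, (Finset.mem_filter.1 hO).2, ?_⟩
  rw [← h, EdgeList.opt]

/-- The factor 3/10 holds for every tape, and the rounding contributes 1/2 in expectation. -/
theorem le_integral_weight_matchOutput (w : G.Weights) :
    3 / 20 * (G.opt w : ℝ) ≤ ∫ ω, (G.weight w (matchOutput G w ω) : ℝ) ∂uniformTape := by
  obtain ⟨O, hO, hopt⟩ := exists_isMatching_weight_eq_opt w
  have hpt : ∀ ω, 3 / 10 * ∑ e ∈ O, roundedWeight G w ω e ≤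
      (G.weight w (matchOutput G w ω) : ℝ) := by
    intro ω
    have h := EdgeList.sum_matching_le_select (r := rankOf G ω) (separated_roundedWeight w ω)
      (roundedWeight_nonneg w ω) hO
    have h' : ∑ e ∈ matchOutput G w ω, roundedWeight G w ω e ≤
        (G.weight w (matchOutput G w ω) : ℝ) := by
      rw [EdgeList.weight, NNReal.coe_sum]
      exact Finset.sum_le_sum fun e _ => roundedWeight_le w ω e
    rw [matchOutput] at h' ⊢
    linarith
  calc 3 / 20 * (G.opt w : ℝ) ≤ 3 / 10 * ∑ e ∈ O, rdMean (w e) := by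
        rw [hopt, EdgeList.weight, NNReal.coe_sum, Finset.mul_sum, Finset.mul_sum]
        refine Finset.sum_le_sum fun e _ => ?_
        have : (w e : ℝ) / 2 ≤ rdMean (w e) := half_le_rdMean (w e).2
        linarith
    _ = ∫ ω, 3 / 10 * ∑ e ∈ O, roundedWeight G w ω e ∂uniformTape := by
        rw [integral_const_mul, integral_finsetSum _ fun e _ => integrable_roundedWeight w e]
        simp only [integral_roundedWeight]
    _ ≤ _ := integral_mono
        ((integrable_finsetSum _ fun e _ => integrable_roundedWeight w e).const_mul _)
        (integrable_comp_edgeSet (measurable_matchOutput w) fun F => (G.weight w F : ℝ)) hpt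

/-! ### Permutations of the tape -/

/-- The permutation of the tape that permutes the ranks of the edges. -/
def tapePerm {m : ℕ} (π : Equiv.Perm (Fin m)) : Equiv.Perm ℕ :=
  π.viaEmbedding (Fin.valEmbedding.trans ⟨Nat.succ, Nat.succ_injective⟩)

theorem tapePerm_zero {m : ℕ} (π : Equiv.Perm (Fin m)) : tapePerm π 0 = 0 := by
  refine Equiv.Perm.viaEmbedding_apply_of_notMem _ _ _ ?_
  rintro ⟨x, hx⟩
  exact Nat.succ_ne_zero _ hx

theorem tapePerm_succ {m : ℕ} (π : Equiv.Perm (Fin m)) (e : Fin m) :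
    tapePerm π (e + 1) = π e + 1 :=
  Equiv.Perm.viaEmbedding_apply π (Fin.valEmbedding.trans ⟨Nat.succ, Nat.succ_injective⟩) e

theorem measurePreserving_comp_perm (τ : Equiv.Perm ℕ) :
    MeasurePreserving (fun ω : ℕ → I => ω ∘ τ) uniformTape uniformTape := by
  refine ⟨by fun_prop, ?_⟩
  have h := Measure.infinitePi_map_piCongrLeft (fun _ : ℕ => (volume : Measure I)) τ.symm
  unfold uniformTape
  convert h using 2
  funext ω i
  simp [MeasurableEquiv.coe_piCongrLeft, Equiv.piCongrLeft_apply]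

theorem matchOutput_comp_tapePerm (w : G.Weights) (ω : ℕ → I) (π : Equiv.Perm (Fin G.m)) :
    matchOutput G w (ω ∘ tapePerm π) = G.select (roundedWeight G w ω) (rankOf G ω ∘ π) := by
  have h1 : roundedWeight G w (ω ∘ tapePerm π) = roundedWeight G w ω := by
    funext e
    simp [roundedWeight, shift, tapePerm_zero]
  have h2 : rankOf G (ω ∘ tapePerm π) = rankOf G ω ∘ π := by
    funext e
    simp [rankOf, tapePerm_succ]
  rw [matchOutput, h1, h2]

/-- The diagonal of the square is a null set by Fubini. -/
theorem ae_tape_ne {i j : ℕ} (hij : i ≠ j) : ∀ᵐ ω ∂uniformTape, ω i ≠ ω j := by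
  have hind := (ProbabilityTheory.iIndepFun_infinitePi (P := fun _ : ℕ => (volume : Measure I))
    (X := fun _ x => x) fun _ => measurable_id).indepFun hij
  have hmi : Measurable fun ω : ℕ → I => ω i := measurable_pi_apply i
  have hmj : Measurable fun ω : ℕ → I => ω j := measurable_pi_apply j
  rw [ProbabilityTheory.indepFun_iff_map_prod_eq_prod_map_map hmi.aemeasurable
    hmj.aemeasurable] at hind
  have hi := (measurePreserving_eval_infinitePi (fun _ : ℕ => (volume : Measure I)) i).map_eq
  have hj := (measurePreserving_eval_infinitePi (fun _ : ℕ => (volume : Measure I)) j).map_eq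
  have hD : MeasurableSet {x : I × I | x.1 = x.2} := measurableSet_eq_fun measurable_fst
    measurable_snd
  have h0 : ((volume : Measure I).prod volume) {x : I × I | x.1 = x.2} = 0 := by
    rw [Measure.measure_prod_null hD]
    refine ae_of_all _ fun x => ?_
    have : Prod.mk x ⁻¹' {x : I × I | x.1 = x.2} = {x} := by
      ext y
      simp [eq_comm]
    simp only [this, Pi.zero_apply, measure_singleton]
  have h1 : uniformTape.map (fun ω => (ω i, ω j)) {x : I × I | x.1 = x.2} = 0 := by
    rw [uniformTape, hind]
    exact (congrArg₂ (fun μ ν : Measure I => (μ.prod ν) {x : I × I | x.1 = x.2}) hi hj).trans h0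
  rw [Measure.map_apply (hmi.prodMk hmj) hD] at h1
  rw [ae_iff]
  simpa using h1

theorem ae_injective_rankOf (G : EdgeList) :
    ∀ᵐ ω ∂uniformTape, Function.Injective (rankOf G ω) := by
  have : ∀ᵐ ω ∂uniformTape, ∀ e f : Fin G.m, e ≠ f → ω (e + 1) ≠ ω (f + 1) := by
    refine ae_all_iff.2 fun e => ae_all_iff.2 fun f => ?_
    by_cases h : e = f
    · exact ae_of_all _ fun _ h' => absurd h h'
    · filter_upwards [ae_tape_ne (i := e + 1) (j := f + 1) (by
        intro h'
        exact h (Fin.ext (by omega)))] with ω hω _ using hω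
  filter_upwards [this] with ω hω e f hef
  by_contra h
  exact hω e f h (Subtype.ext hef)

/-! ### Lipschitz continuity -/

/-- The expected distance of the outputs for two weight vectors on the same random tape. -/
def meanDist (w w' : G.Weights) : ℝ≥0∞ :=
  ∫⁻ ω, ENNReal.ofReal (G.dw (matchOutput G w ω) w (matchOutput G w' ω) w') ∂uniformTape

theorem measurable_dw_matchOutput (w w' : G.Weights) : Measurable fun ω =>
    ENNReal.ofReal (G.dw (matchOutput G w ω) w (matchOutput G w' ω) w') := by
  have h : Measurable fun x : Finset (Fin G.m) × Finset (Fin G.m) =>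
      ENNReal.ofReal (G.dw x.1 w x.2 w') := Measurable.of_discrete
  have h' := h.comp ((measurable_matchOutput w).prodMk (measurable_matchOutput w'))
  exact h'

theorem meanDist_triangle (w w' w'' : G.Weights) :
    meanDist w w'' ≤ meanDist w w' + meanDist w' w'' := by
  unfold meanDist
  rw [← lintegral_add_left (measurable_dw_matchOutput w w')]
  refine lintegral_mono fun ω => ?_
  rw [← ENNReal.ofReal_add (EdgeList.dw_nonneg _ _ _ _) (EdgeList.dw_nonneg _ _ _ _)]
  exact ENNReal.ofReal_le_ofReal (EdgeList.dw_triangle _ _ _ _ _ _)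

/-- Permuting the rank positions of the tape preserves its law and fixes the shift. The expectation
may thus be averaged over all permutations of given ranks, which is the form of the counting bound.
-/
theorem meanDist_eq_comp_perm (w w' : G.Weights) (π : Equiv.Perm (Fin G.m)) :
    meanDist w w' = ∫⁻ ω, ENNReal.ofReal (G.dw (G.select (roundedWeight G w ω) (rankOf G ω ∘ π)) w
      (G.select (roundedWeight G w' ω) (rankOf G ω ∘ π)) w') ∂uniformTape := by
  rw [meanDist, ← (measurePreserving_comp_perm (tapePerm π)).lintegral_comp
    (measurable_dw_matchOutput w w')]
  simp only [matchOutput_comp_tapePerm]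

/-- Rounding is monotone for every shift, so the difference has constant sign and its mean absolute
value is a difference of means. -/
theorem integral_abs_roundedWeight_sub_le (w w' : G.Weights) (e : Fin G.m) :
    ∫ ω, |roundedWeight G w ω e - roundedWeight G w' ω e| ∂uniformTape ≤ |(w e : ℝ) - w' e| := by
  have key : ∀ w w' : G.Weights, (w e : ℝ) ≤ w' e →
      ∫ ω, |roundedWeight G w ω e - roundedWeight G w' ω e| ∂uniformTape ≤
        |(w e : ℝ) - w' e| := by
    intro w w' h
    have hpt : ∀ ω, |roundedWeight G w ω e - roundedWeight G w' ω e| =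
        roundedWeight G w' ω e - roundedWeight G w ω e := by
      intro ω
      rw [abs_sub_comm, abs_of_nonneg]
      exact sub_nonneg.2 (rd_mono (one_le_shift ω) (shift_le_four ω) (w e).2 h)
    simp only [hpt]
    rw [integral_sub (integrable_roundedWeight w' e) (integrable_roundedWeight w e),
      integral_roundedWeight, integral_roundedWeight, abs_sub_comm,
      abs_of_nonneg (sub_nonneg.2 h)]
    exact rdMean_sub_le (w e).2 h
  rcases le_total (w e : ℝ) (w' e) with h | h
  · exact key w w' h
  · rw [abs_sub_comm (w e : ℝ)]
    refine le_trans (le_of_eq ?_) (key w' w h)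
    exact integral_congr_ae (ae_of_all _ fun ω => abs_sub_comm _ _)

/-- The effect of changing the weight of a single edge. -/
theorem meanDist_le_of_eq_off {w w' : G.Weights} (e : Fin G.m) (h : ∀ f, f ≠ e → w f = w' f) :
    meanDist w w' ≤ ENNReal.ofReal (21 * |(w e : ℝ) - w' e|) := by
  set N := Fintype.card (Equiv.Perm (Fin G.m)) with hN
  have hNpos : 0 < N := Fintype.card_pos
  have hint' : Integrable (fun ω => 20 * |roundedWeight G w ω e - roundedWeight G w' ω e|)
      uniformTape :=
    ((integrable_roundedWeight w e).sub (integrable_roundedWeight w' e)).abs.const_mul _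
  have hint : Integrable (fun ω => |(w e : ℝ) - w' e| +
      20 * |roundedWeight G w ω e - roundedWeight G w' ω e|) uniformTape :=
    (integrable_const _).add hint'
  have hsum : (N : ℝ≥0∞) * meanDist w w' ≤
      (N : ℝ≥0∞) * ENNReal.ofReal (21 * |(w e : ℝ) - w' e|) := by
    calc (N : ℝ≥0∞) * meanDist w w'
        = ∑ π : Equiv.Perm (Fin G.m), ∫⁻ ω, ENNReal.ofReal
            (G.dw (G.select (roundedWeight G w ω) (rankOf G ω ∘ π)) w
              (G.select (roundedWeight G w' ω) (rankOf G ω ∘ π)) w') ∂uniformTape := by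
          simp only [← meanDist_eq_comp_perm]
          rw [Finset.sum_const, Finset.card_univ, nsmul_eq_mul]
      _ = ∫⁻ ω, ∑ π : Equiv.Perm (Fin G.m), ENNReal.ofReal
            (G.dw (G.select (roundedWeight G w ω) (rankOf G ω ∘ π)) w
              (G.select (roundedWeight G w' ω) (rankOf G ω ∘ π)) w') ∂uniformTape := by
          rw [lintegral_finsetSum]
          intro π _
          simp only [← matchOutput_comp_tapePerm]
          exact (measurable_dw_matchOutput w w').comp
            (measurePreserving_comp_perm (tapePerm π)).measurable
      _ ≤ ∫⁻ ω, (N : ℝ≥0∞) * ENNReal.ofReal (|(w e : ℝ) - w' e| +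
            20 * |roundedWeight G w ω e - roundedWeight G w' ω e|) ∂uniformTape := by
          refine lintegral_mono_ae ?_
          -- The counting bound needs distinct ranks, which occur almost surely.
          filter_upwards [ae_injective_rankOf G] with ω hω
          rw [← ENNReal.ofReal_sum_of_nonneg fun π _ => EdgeList.dw_nonneg _ _ _ _,
            ← ENNReal.ofReal_natCast, ← ENNReal.ofReal_mul (Nat.cast_nonneg _)]
          refine ENNReal.ofReal_le_ofReal ?_
          exact EdgeList.sum_dw_select_le (separated_roundedWeight w ω) (roundedWeight_nonneg w ω)
            (separated_roundedWeight w' ω) (roundedWeight_nonneg w' ω)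
            (le_four_mul_roundedWeight w ω) (le_four_mul_roundedWeight w' ω) e
            (fun f hf => by rw [roundedWeight, roundedWeight, h f hf]) h
            (four_mul_rd_le (one_le_shift ω) (shift_le_four ω) (w e).2 (w' e).2)
            (four_mul_rd_le (one_le_shift ω) (shift_le_four ω) (w' e).2 (w e).2) hω
      _ = (N : ℝ≥0∞) * ENNReal.ofReal (∫ ω, (|(w e : ℝ) - w' e| +
            20 * |roundedWeight G w ω e - roundedWeight G w' ω e|) ∂uniformTape) := by
          rw [lintegral_const_mul' _ _ (ENNReal.natCast_ne_top N),
            ofReal_integral_eq_lintegral_ofReal hint (ae_of_all _ fun ω => by positivity)]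
      _ ≤ _ := by
          gcongr
          rw [integral_add (integrable_const _) hint', integral_const_mul]
          have := integral_abs_roundedWeight_sub_le w w' e
          simp only [integral_const, probReal_univ, one_smul]
          linarith
  exact (ENNReal.mul_le_mul_iff_right (by exact_mod_cast hNpos.ne')
    (ENNReal.natCast_ne_top N)).1 hsum

theorem meanDist_self (w : G.Weights) : meanDist w w = 0 := by
  simp [meanDist, EdgeList.dw]

/-- The coordinates are switched from `w` to `w'` one at a time, and the triangle inequality adds
the costs. -/
theorem meanDist_le (w w' : G.Weights) :
    meanDist w w' ≤ ENNReal.ofReal (21 * G.l1Dist w w') := by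
  classical
  have key : ∀ S : Finset (Fin G.m), meanDist w (S.piecewise w' w) ≤
      ENNReal.ofReal (21 * ∑ e ∈ S, |(w e : ℝ) - w' e|) := by
    intro S
    induction S using Finset.induction_on with
    | empty => simp [meanDist_self]
    | insert e S he ih =>
      have h1 := meanDist_le_of_eq_off (w := S.piecewise w' w) (w' := (insert e S).piecewise w' w) e
        (fun f hf => by
          by_cases hfS : f ∈ S <;> simp [hfS, hf])
      rw [Finset.piecewise_eq_of_notMem S w' w he,
        Finset.piecewise_eq_of_mem _ w' w (Finset.mem_insert_self e S)] at h1
      refine (meanDist_triangle _ _ _).trans ((add_le_add ih h1).trans (le_of_eq ?_))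
      rw [← ENNReal.ofReal_add (by positivity) (by positivity), Finset.sum_insert he]
      congr 1
      ring
  have := key Finset.univ
  rwa [Finset.piecewise_univ] at this

/-- The output law of the algorithm. -/
def matchLaw : OutputLaw := fun _ w => lawOf (measurable_matchOutput w)

theorem hasOutputLaw_matchLaw : HasOutputLaw matchProg matchLaw := by
  intro G w F
  simp only [returns_matchProg]
  exact (lawOf_apply _ F).symm

theorem isApproxMatching_matchLaw : IsApproxMatching (3 / 20) matchLaw := by
  intro G w
  constructor
  · intro F hF
    rw [PMF.mem_support_iff, matchLaw, lawOf_apply] at hF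
    obtain ⟨ω, hω⟩ := nonempty_of_measure_ne_zero hF
    rw [← (hω : matchOutput G w ω = F)]
    exact EdgeList.isMatching_select _ _
  · have h := sum_lawOf_toReal_mul (measurable_matchOutput w) fun F => (G.weight w F : ℝ)
    rw [matchLaw, h]
    exact le_integral_weight_matchOutput w

theorem lipschitzConst_matchLaw_le (G : EdgeList) :
    G.lipschitzConst (matchLaw G) ≤ ENNReal.ofReal 21 := by
  refine iSup_le fun w => iSup_le fun w' => iSup_le fun _ => ENNReal.div_le_of_le_mul ?_
  rw [← ENNReal.ofReal_mul (by norm_num)]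
  exact (earthMover_lawOf_le _ _ w w').trans (meanDist_le w w')

end LipMatching

end

theorem mainTheorem4 :
    ∃ C : ℝ, 0 < C ∧ ∀ ε : ℝ, 0 < ε → ε < 1 / 8 →
      ∃ (P : LipMatching.Prog) (A : LipMatching.OutputLaw),
        LipMatching.PolyTime P ∧
        LipMatching.HasOutputLaw P A ∧
        LipMatching.IsApproxMatching (1 / 8 - ε) A ∧
        ∀ G : LipMatching.EdgeList, G.lipschitzConst (A G) ≤ ENNReal.ofReal (C / ε) := by
  -- The program does not depend on `ε`; only `1 / 8 - ε ≤ 3 / 20` and `ε ≤ 1` are used. The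
  -- constant 21 is 1 for the weight change itself plus 20 for the rounded one.
  refine ⟨21, by norm_num, fun ε h0 h1 => ⟨LipMatching.matchProg, LipMatching.matchLaw,
    LipMatching.polyTime_matchProg, LipMatching.hasOutputLaw_matchLaw, fun G w => ?_, fun G => ?_⟩⟩
  · obtain ⟨hM, hA⟩ := LipMatching.isApproxMatching_matchLaw G w
    exact ⟨hM, le_trans (mul_le_mul_of_nonneg_right (by linarith) (G.opt w).2) hA⟩
  · refine (LipMatching.lipschitzConst_matchLaw_le G).trans (ENNReal.ofReal_le_ofReal ?_)
    rw [le_div_iff₀ h0]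
    linarith
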